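/- A graph is a vertex set with a reflexive, symmetric edge relation; an epimorphism is an edge-preserving map that is surjective on vertices and on edges, and epimorphisms of rooted graphs also preserve the root. A topological graph is a graph on a compact, zero-dimensional, second countable Hausdorff space with closed edge relation; finite graphs carry the discrete topology. A set $S$ of vertices is connected if it is not the union of two nonempty relatively closed subsets with no edge from one to the other. A map $f:G\to H$ is confluent if $f(C)=Q$ for each closed connected $Q\subseteq H$ and each component $C$ of $f^{-1}(Q)$, and monotone if preimages of closed connected sets are connected. A projective Fraïssé family is a nonempty family of finite (rooted) graphs, countable up to isomorphism, with a fixed class of epimorphisms that contains the identities, is closed under composition, and has the joint projection and projective amalgamation properties. A topological graph is Kelley if it is connected and for each closed connected $K$, each $p\in K$ and each sequence $x_i\to p$ there are closed connected $L_i\ni x_i$ with $L_i\to K$ in the Hausdorff sense. An arc with end vertices $a\ne b$ is a closed connected set $S\ni a,b$ such that $S\setminus\{x\}$ is not connected for every $x\in S\setminus\{a,b\}$; a topological graph is arcwise connected if any two distinct vertices are the end vertices of an arc. For integers $n>k\ge 1$ let $R_{n,k}(12/3)$ be the set of restricted growth functions of length $n$ with maximal letter $k$ whose set partition of $[n]$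 avoids the pattern $12/3$, and also the rooted tree whose vertices are the prefixes of these words, the root being the empty word and each word being joined to its one-letter extensions. Let $R_{n,k,L}(12/3)$ be the graph obtained by adding a vertex $\varepsilon$ joined to all vertices of the bottom level (the words of length $n$). (1) $R_{n,k}(12/3)$ is a tree, and it is isomorphic, as a rooted graph, to a path of length $k$ starting at the root followed, at its end, by $k$ branches, each a path of length $n-k$. Ordered with the root on top and $\varepsilon$ at the bottom, the vertices of $R_{n,k,L}(12/3)$ form a lattice, with $R_{n,k,L}(12/3)$ as its Hasse diagram. (2) Let $A=\{(n,k): n>k\ge1\}$, with $(n_1,k_1)\ge(n_2,k_2)$ if and only if $n_1\ge n_2$, $k_1\ge k_2$ and $n_1-n_2\ge k_1-k_2$. For $(n_1,k_1)\ge(n_2,k_2)$ let $\phi:R_{n_1,k_1}(12/3)\to R_{n_2,k_2}(12/3)$ collapse the top $k_1-k_2$ edges of the initial path to the root and map the remainder of the path identically onto the path of the target; map the branch with letter $a$ to the branch with letter $a$ if $a\le k_2$ and to the leftmost branch (letter $1$) if $a>k_2$, preserving the depth on the branch up to $n_2-k_2$ and collapsing the bottom $(n_1-k_1)-(n_2-k_2)$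 edges to the end vertex of the branch. Extend $\phi$ to $R_{n_1,k_1,L}(12/3)\to R_{n_2,k_2,L}(12/3)$ by $\varepsilon\mapsto\varepsilon$. Then, both for the trees and for the lattices, all these maps are confluent epimorphisms of rooted graphs, they are not all monotone, and the graphs with these maps form a projective Fraïssé family. Its projective Fraïssé limit is the inverse limit over $A$ (with the topology of the product of discrete spaces, and two threads joined when they are joined in each coordinate), and this limit is Kelley. (3) For each fixed $k\ge1$, again both for the trees and for the lattices, the maps $\phi$ between the members with $k_1=k_2=k$ are monotone, these members form a projective Fraïssé family, and its projective Fraïssé limit, the inverse limit over $n>k$, is arcwise connected. -/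

import Mathlib

open Set Filter Topology TopologicalSpace

/-! ### Reflexive graphs, connectedness, epimorphisms -/

/-- A graph: a vertex set with a reflexive and symmetric edge relation. -/
structure ReflGraph (V : Type) where
  Adj : V → V → Prop
  refl : ∀ a, Adj a a
  symm : ∀ a b, Adj a b → Adj b a

/-- The graph whose nondegenerate edges are the steps of `r`, read in both directions. -/
def ReflGraph.ofStep {V : Type} (r : V → V → Prop) : ReflGraph V where
  Adj a b := a = b ∨ r a b ∨ r b a
  refl _ := Or.inl rfl
  symm _ _ h := by tauto

/-- The underlying simple graph (degenerate edges removed). -/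
def ReflGraph.toSimpleGraph {V : Type} (G : ReflGraph V) : SimpleGraph V :=
  SimpleGraph.fromRel G.Adj

/-- `f` maps edges to edges and is surjective on vertices and on edges. -/
structure ReflGraph.IsEpi {V W : Type} (G : ReflGraph V) (H : ReflGraph W) (f : V → W) :
    Prop where
  hom : ∀ a b, G.Adj a b → H.Adj (f a) (f b)
  surj : Function.Surjective f
  edge_surj : ∀ c d, H.Adj c d → ∃ a b, G.Adj a b ∧ f a = c ∧ f b = d

/-- An epimorphism between the rooted graphs `(G, r)` and `(H, s)`. -/
structure ReflGraph.IsRootedEpi {V W : Type} (G : ReflGraph V) (r : V) (H : ReflGraph W) (s : W)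
    (f : V → W) : Prop where
  epi : G.IsEpi H f
  map_root : f r = s

/-- An isomorphism of rooted graphs is an injective epimorphism. -/
structure ReflGraph.IsRootedIso {V W : Type} (G : ReflGraph V) (r : V) (H : ReflGraph W) (s : W)
    (f : V → W) : Prop where
  epi : G.IsRootedEpi r H s f
  inj : Function.Injective f

/-- `S` is connected in the topological graph `G`: it is not the union of two nonempty, relatively
closed subsets with no edge from the one to the other. -/
def ReflGraph.IsConnectedSet {V : Type} [TopologicalSpace V] (G : ReflGraph V) (S : Set V) : Prop :=
  ¬ ∃ P Q : Set V, P.Nonempty ∧ Q.Nonempty ∧ P ∪ Q = S ∧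
    (∃ C, IsClosed C ∧ P = C ∩ S) ∧ (∃ D, IsClosed D ∧ Q = D ∩ S) ∧
    ∀ a ∈ P, ∀ b ∈ Q, ¬ G.Adj a b

/-- `C` is a component of `S`: a maximal nonempty connected subset of `S`. -/
def ReflGraph.IsComponent {V : Type} [TopologicalSpace V] (G : ReflGraph V) (S C : Set V) : Prop :=
  Maximal (fun D : Set V => D.Nonempty ∧ D ⊆ S ∧ G.IsConnectedSet D) C

/-- A map is confluent if every component of the preimage of a closed connected set is mapped
onto that set. -/
def ReflGraph.IsConfluent {V W : Type} [TopologicalSpace V] [TopologicalSpace W]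
    (G : ReflGraph V) (H : ReflGraph W) (f : V → W) : Prop :=
  ∀ Q : Set W, IsClosed Q → H.IsConnectedSet Q →
    ∀ C : Set V, G.IsComponent (f ⁻¹' Q) C → f '' C = Q

/-- A map is monotone if preimages of closed connected sets are connected. -/
def ReflGraph.IsMonotone {V W : Type} [TopologicalSpace V] [TopologicalSpace W]
    (G : ReflGraph V) (H : ReflGraph W) (f : V → W) : Prop :=
  ∀ Q : Set W, IsClosed Q → H.IsConnectedSet Q → G.IsConnectedSet (f ⁻¹' Q)

/-- A topological graph: the vertex space is compact, zero-dimensional, Hausdorff and second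
countable, and the edge relation is closed. -/
structure ReflGraph.IsTopologicalGraph {V : Type} [TopologicalSpace V] (G : ReflGraph V) :
    Prop where
  compact : CompactSpace V
  t2 : T2Space V
  zeroDim : IsTopologicalBasis {s : Set V | IsClopen s}
  secondCountable : SecondCountableTopology V
  closed_edges : IsClosed {e : V × V | G.Adj e.1 e.2}

/-- A topological graph is Kelley if it is connected and, for each closed connected set `K`, each
`p ∈ K` and each sequence `x n → p`, there are closed connected sets `L n ∋ x n` with `L n → K`.
Convergence is in the Vietoris topology, that is, for the Hausdorff distance of any compatible
metric. -/
def ReflGraph.IsKelley {V : Type} [TopologicalSpace V] (G : ReflGraph V) : Prop :=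
  G.IsConnectedSet univ ∧
  ∀ K : NonemptyCompacts V, G.IsConnectedSet (K : Set V) → ∀ p ∈ K, ∀ x : ℕ → V,
    Tendsto x atTop (𝓝 p) →
    ∃ L : ℕ → NonemptyCompacts V,
      (∀ n, G.IsConnectedSet (L n : Set V) ∧ x n ∈ L n) ∧ Tendsto L atTop (𝓝 K)

/-- `S`, with all edges of `G` between its points, is an arc with end vertices `a ≠ b`: it is
closed, connected, contains `a` and `b`, and removing any other vertex disconnects it. -/
structure ReflGraph.IsArc {V : Type} [TopologicalSpace V] (G : ReflGraph V) (a b : V)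
    (S : Set V) : Prop where
  ne : a ≠ b
  left_mem : a ∈ S
  right_mem : b ∈ S
  closed : IsClosed S
  connected : G.IsConnectedSet S
  cut : ∀ x ∈ S, x ≠ a → x ≠ b → ¬ G.IsConnectedSet (S \ {x})

/-- Any two distinct vertices are the end vertices of an arc. -/
def ReflGraph.IsArcwiseConnected {V : Type} [TopologicalSpace V] (G : ReflGraph V) : Prop :=
  ∀ a b : V, a ≠ b → ∃ S : Set V, G.IsArc a b S

/-! ### Families of rooted graphs with bonding maps, and their limits -/

/-- Rooted graphs indexed by a preorder, with one map from the larger to the smaller index for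
each comparable pair. -/
structure BondedFamily (I : Type) [Preorder I] where
  V : I → Type
  graph : ∀ i, ReflGraph (V i)
  root : ∀ i, V i
  bond : ∀ {i j : I}, j ≤ i → V i → V j

namespace BondedFamily

variable {I : Type} [Preorder I] (F : BondedFamily I)

/-- The members of the family carry the discrete topology. -/
instance (i : I) : TopologicalSpace (F.V i) := ⊥

instance (i : I) : DiscreteTopology (F.V i) := ⟨rfl⟩

/-- The subfamily over a subset of the index set. -/
def restrict (S : Set I) : BondedFamily S where
  V i := F.V i
  graph i := F.graph i
  root i := F.root i
  bond {i j} h := F.bond (i := (i : I)) (j := (j : I)) h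

/-- The distinguished maps from the `i`-th to the `j`-th member. -/
def epis (i j : I) : Set (F.V i → F.V j) := {f | ∃ h : j ≤ i, f = F.bond h}

/-- The finite rooted graphs of the family, with the distinguished maps, form a projective Fraïssé
family. -/
structure IsProjectiveFraisse : Prop where
  nonempty : Nonempty I
  finite : ∀ i, Finite (F.V i)
  isEpi : ∀ i j, ∀ f ∈ F.epis i j, (F.graph i).IsRootedEpi (F.root i) (F.graph j) (F.root j) f
  countable : ∀ S : Set I,
    S.Pairwise (fun i j => ¬ ∃ f : F.V i → F.V j,
      (F.graph i).IsRootedIso (F.root i) (F.graph j) (F.root j) f) → S.Countable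
  id_mem : ∀ i, id ∈ F.epis i i
  comp_mem : ∀ i j k, ∀ f ∈ F.epis i j, ∀ g ∈ F.epis j k, g ∘ f ∈ F.epis i k
  joint : ∀ b c, ∃ d, ∃ f ∈ F.epis d b, ∃ g ∈ F.epis d c, True
  amalgamation : ∀ a b c, ∀ f ∈ F.epis b a, ∀ g ∈ F.epis c a,
    ∃ d, ∃ f₀ ∈ F.epis d b, ∃ g₀ ∈ F.epis d c, f ∘ f₀ = g ∘ g₀

/-- The vertex space of the inverse limit: all threads. -/
def Limit : Type := {x : ∀ i, F.V i // ∀ i j (h : j ≤ i), F.bond h (x i) = x j}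

/-- The topology of the inverse limit as a subspace of the product of discrete spaces. -/
instance : TopologicalSpace F.Limit :=
  inferInstanceAs (TopologicalSpace {x : ∀ i, F.V i // ∀ i j (h : j ≤ i), F.bond h (x i) = x j})

/-- The canonical projection of the limit to the `i`-th member. -/
def proj (i : I) (x : F.Limit) : F.V i := x.1 i

/-- The graph structure of the inverse limit: two threads span an edge if all their coordinates
do. -/
def limitGraph : ReflGraph F.Limit where
  Adj x y := ∀ i, (F.graph i).Adj (F.proj i x) (F.proj i y)
  refl _ i := (F.graph i).refl _
  symm _ _ h i := (F.graph i).symm _ _ (h i)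

/-- The epimorphisms from the limit to the `i`-th member that are induced by the family: a
projection followed by a distinguished map. -/
def limitEpis (i : I) : Set (F.Limit → F.V i) :=
  {f | ∃ (j : I) (h : i ≤ j), f = F.bond h ∘ F.proj j}

/-- The inverse limit is the projective Fraïssé limit of the family: it is a topological graph
rooted at the thread `r` of roots, it maps onto each member, maps to members lift along
distinguished maps, and the fibres of maps to members refine every open cover. -/
structure IsProjectiveFraisseLimit : Prop where
  topological : F.limitGraph.IsTopologicalGraph
  projective_universality : ∀ i, (F.limitEpis i).Nonempty
  epi : ∃ r : F.Limit, ∀ i, ∀ f ∈ F.limitEpis i,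
    Continuous f ∧ F.limitGraph.IsRootedEpi r (F.graph i) (F.root i) f
  lift : ∀ i j, ∀ f ∈ F.limitEpis i, ∀ g ∈ F.epis j i, ∃ h ∈ F.limitEpis j, f = g ∘ h
  refine_cover : ∀ 𝒰 : Set (Set F.Limit), (∀ U ∈ 𝒰, IsOpen U) → ⋃₀ 𝒰 = univ →
    ∃ i, ∃ f ∈ F.limitEpis i, ∀ v, ∃ U ∈ 𝒰, f ⁻¹' {v} ⊆ U

end BondedFamily

/-! ### Restricted growth functions and pattern avoidance -/

/-- The largest letter of a word (`0` for the empty word). -/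
def maxLetter (w : List ℕ) : ℕ := w.foldr max 0

/-- Restricted growth functions `a₁ a₂ ⋯ aₙ`: positive integers, `a₁ = 1` and
`aᵢ ≤ 1 + max {a₁, …, aᵢ₋₁}` for `i ≥ 2`. -/
structure IsRGF (w : List ℕ) : Prop where
  pos : ∀ a ∈ w, 1 ≤ a
  first : ∀ h : 0 < w.length, w[0] = 1
  growth : ∀ (i : ℕ) (h : i < w.length), 1 ≤ i → w[i] ≤ 1 + maxLetter (w.take i)

/-- The set partition encoded by a word: positions are in the same block if they carry the same
letter. Set partitions of an `m`-element initial segment are given by their equivalence relation. -/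
def wordPartition (w : List ℕ) : Setoid (Fin w.length) := Setoid.ker w.get

/-- `σ` contains the pattern `π` if some sub-partition of `σ` standardizes to `π`. -/
def ContainsPattern {n m : ℕ} (σ : Setoid (Fin n)) (π : Setoid (Fin m)) : Prop :=
  ∃ f : Fin m ↪o Fin n, Setoid.comap f σ = π

/-- The restricted growth functions of length `n` with maximal letter `k` that avoid `π`. -/
def avoidingRGF (n k : ℕ) {m : ℕ} (π : Setoid (Fin m)) : Set (List ℕ) :=
  {w | IsRGF w ∧ w.length = n ∧ maxLetter w = k ∧ ¬ ContainsPattern (wordPartition w) π}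

/-- The set partition `12/3`. -/
def pattern12_3 : Setoid (Fin 3) := Setoid.ker ![1, 1, 2]

/-! ### The trees and lattices of the words avoiding `12/3` -/

/-- The index set: pairs of positive integers with `n > k`. -/
@[ext]
structure RIndex where
  n : ℕ
  k : ℕ
  pos : 1 ≤ k
  lt : k < n

/-- `q ≤ p` means `n_p ≥ n_q`, `k_p ≥ k_q` and `n_p - n_q ≥ k_p - k_q`. -/
instance : Preorder RIndex where
  le q p := q.n ≤ p.n ∧ q.k ≤ p.k ∧ (p.k : ℤ) - q.k ≤ (p.n : ℤ) - q.n
  le_refl p := by simp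
  le_trans a b c h h' := by omega

/-- Vertices of the tree: all prefixes of the words. The maximal chains
from the root (the empty word) spell exactly the words. -/
@[ext]
structure TreeVertex (p : RIndex) where
  word : List ℕ
  mem : ∃ w ∈ avoidingRGF p.n p.k pattern12_3, word <+: w

/-- The tree order, with the root on top. -/
instance (p : RIndex) : PartialOrder (TreeVertex p) where
  le u v := v.word <+: u.word
  le_refl u := List.prefix_refl _
  le_trans u v w h h' := h'.trans h
  le_antisymm u v h h' := TreeVertex.ext (h'.eq_of_length (le_antisymm h'.length_le h.length_le))

/-- The tree `R_{n,k}(12/3)`: a word is joined to its extensions by one letter (the label of the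
edge). -/
def treeGraph (p : RIndex) : ReflGraph (TreeVertex p) :=
  ReflGraph.ofStep fun u v => ∃ a, v.word = u.word ++ [a]

/-- The tree together with a new bottom element `⊥`, which plays the role of `ε`. -/
abbrev LatticeVertex (p : RIndex) : Type := WithBot (TreeVertex p)

/-- The graph of the lattice `R_{n,k,L}(12/3)`: the tree, with `⊥` joined to each vertex of the
bottom level. -/
def latticeGraph (p : RIndex) : ReflGraph (LatticeVertex p) :=
  ReflGraph.ofStep fun x y =>
    (∃ u v : TreeVertex p, x = u ∧ y = v ∧ ∃ a, v.word = u.word ++ [a]) ∨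
    (∃ u : TreeVertex p, x = u ∧ u.word.length = p.n ∧ y = ⊥)

/-- The word `1 2 ⋯ j`. -/
def initialRun (j : ℕ) : List ℕ := List.range' 1 j

/-- The effect of the collapsing map on words. On the initial path the `k_p - k_q` top edges are
collapsed to the root. On the branch with letter `a`, all vertices beyond depth `n_q - k_q` are
collapsed to the end of the branch; the branch goes to the branch with letter `a` if `a ≤ k_q`, and
to the leftmost branch, with letter `1`, otherwise. -/
def collapseWord (p q : RIndex) (u : List ℕ) : List ℕ :=
  if u.length ≤ p.k then initialRun (u.length - (p.k - q.k))
  else initialRun q.k ++ List.replicate (min (u.length - p.k) (q.n - q.k))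
    (if u.getLastD 1 ≤ q.k then u.getLastD 1 else 1)

theorem maxLetter_append (u v : List ℕ) : maxLetter (u ++ v) = max (maxLetter u) (maxLetter v) := by
  induction u with
  | nil => simp [maxLetter]
  | cons a u ih =>
    simp only [maxLetter, List.cons_append, List.foldr_cons] at ih ⊢
    rw [ih, max_assoc]

theorem maxLetter_initialRun (j : ℕ) : maxLetter (initialRun j) = j := by
  induction j with
  | zero => rfl
  | succ j ih =>
    rw [initialRun, List.range'_1_concat, maxLetter_append]
    rw [initialRun] at ih
    rw [ih]; simp [maxLetter]; omega

theorem maxLetter_replicate_le (m b : ℕ) : maxLetter (List.replicate m b) ≤ b := by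
  induction m with
  | zero => simp [maxLetter]
  | succ m ih => simpa [maxLetter, List.replicate_succ] using ih

/-- The words `1 2 ⋯ k b b ⋯ b` with `1 ≤ b ≤ k` avoid `12/3`. -/
theorem branchWord_mem (p : RIndex) (b : ℕ) (hb : 1 ≤ b) (hbk : b ≤ p.k) :
    initialRun p.k ++ List.replicate (p.n - p.k) b ∈ avoidingRGF p.n p.k pattern12_3 := by
  have hlt := p.lt
  have hpos := p.pos
  have hlen : (initialRun p.k ++ List.replicate (p.n - p.k) b).length = p.n := by
    simp [initialRun]; omega
  have hget : ∀ (i : ℕ) (h : i < (initialRun p.k ++ List.replicate (p.n - p.k) b).length),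
      (initialRun p.k ++ List.replicate (p.n - p.k) b)[i] = if i < p.k then i + 1 else b := by
    intro i h
    rw [List.getElem_append]
    simp [initialRun, add_comm]
  refine ⟨⟨?_, ?_, ?_⟩, hlen, ?_, ?_⟩
  · intro a ha
    simp only [initialRun, List.mem_append, List.mem_range'_1, List.mem_replicate] at ha
    omega
  · intro h
    rw [hget]; simp; omega
  · intro i h hi
    rw [hget, List.take_append, maxLetter_append]
    have h1 : (initialRun p.k).take i = initialRun (min i p.k) := by
      rw [initialRun, initialRun]
      refine List.ext_getElem (by simp) fun j _ _ => ?_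
      simp
    rw [h1, maxLetter_initialRun]
    have : min i p.k ≤ max (min i p.k) (maxLetter (List.take (i - (initialRun p.k).length)
      (List.replicate (p.n - p.k) b))) := le_max_left _ _
    split_ifs <;> omega
  · rw [maxLetter_append, maxLetter_initialRun]
    exact max_eq_left ((maxLetter_replicate_le _ _).trans hbk)
  · rintro ⟨f, hf⟩
    have key : ∀ i j : Fin 3, (initialRun p.k ++ List.replicate (p.n - p.k) b)[(f i : ℕ)] =
        (initialRun p.k ++ List.replicate (p.n - p.k) b)[(f j : ℕ)] ↔
        (![1, 1, 2] : Fin 3 → ℕ) i = ![1, 1, 2] j := by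
      intro i j
      have := congrArg (fun s : Setoid (Fin 3) => s.r i j) hf
      exact iff_of_eq this
    have h01 : (f 0 : ℕ) < f 1 := f.strictMono (by decide)
    have h12 : (f 1 : ℕ) < f 2 := f.strictMono (by decide)
    have k01 := (key 0 1).2 (by simp)
    have k02 := mt (key 1 2).1 (by simp)
    rw [hget, hget] at k01 k02
    split_ifs at k01 k02 <;> omega

theorem TreeVertex.one_le_getLastD {p : RIndex} (u : TreeVertex p) : 1 ≤ u.word.getLastD 1 := by
  obtain ⟨w, hw, hu⟩ := u.mem
  rw [List.getLastD_eq_getLast?]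
  rcases h : u.word.getLast? with _ | a
  · simp
  · exact hw.1.pos a (hu.subset (List.mem_of_getLast? h))

theorem collapseWord_mem (p q : RIndex) (u : TreeVertex p) :
    u.word.length ≤ p.n → q.k ≤ p.k →
      ∃ w ∈ avoidingRGF q.n q.k pattern12_3, collapseWord p q u.word <+: w := by
  intro hn hk
  have hpos := q.pos
  have hu := u.one_le_getLastD
  rw [collapseWord]
  split_ifs with h h'
  · refine ⟨_, branchWord_mem q 1 le_rfl hpos, List.IsPrefix.trans ?_ (List.prefix_append _ _)⟩
    exact ⟨List.range' (1 + (u.word.length - (p.k - q.k))) (q.k - (u.word.length - (p.k - q.k))),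
      by rw [initialRun, initialRun, List.range'_append_1]; congr 1; omega⟩
  · refine ⟨_, branchWord_mem q _ hu h', (List.prefix_append_right_inj _).2 ?_⟩
    exact ⟨List.replicate (q.n - q.k - min (u.word.length - p.k) (q.n - q.k)) _,
      by rw [List.replicate_append_replicate]; congr 1; omega⟩
  · refine ⟨_, branchWord_mem q 1 le_rfl hpos, (List.prefix_append_right_inj _).2 ?_⟩
    exact ⟨List.replicate (q.n - q.k - min (u.word.length - p.k) (q.n - q.k)) _,
      by rw [List.replicate_append_replicate]; congr 1; omega⟩

theorem TreeVertex.length_le {p : RIndex} (u : TreeVertex p) : u.word.length ≤ p.n := by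
  obtain ⟨w, hw, hu⟩ := u.mem
  exact hu.length_le.trans hw.2.1.le

/-- The collapsing map between the trees. -/
def collapse {p q : RIndex} (h : q ≤ p) (u : TreeVertex p) : TreeVertex q :=
  ⟨collapseWord p q u.word, collapseWord_mem p q u u.length_le h.2.1⟩

/-- The root of the tree: the empty word. -/
def treeRoot (p : RIndex) : TreeVertex p :=
  ⟨[], _, branchWord_mem p 1 le_rfl p.pos, List.nil_prefix⟩

/-- The trees `R_{n,k}(12/3)`, rooted at the empty word, with the collapsing maps. -/
def treeFamily : BondedFamily RIndex where
  V := TreeVertex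
  graph := treeGraph
  root := treeRoot
  bond := collapse

/-- The lattice graphs with the collapsing maps, extended by `ε ↦ ε`. -/
def latticeFamily : BondedFamily RIndex where
  V := LatticeVertex
  graph := latticeGraph
  root p := (treeRoot p : LatticeVertex p)
  bond h := WithBot.map (collapse h)

/-! ### The model shape -/

/-- The vertices of a path with `k` edges, followed at its end by `k` branches with `l` edges
each: `inl i` is the vertex at distance `i` from the root on the path, `inr (b, d)` is the vertex
at distance `d + 1` from the end of the path on the branch `b`. -/
abbrev BroomVertex (k l : ℕ) : Type := Fin (k + 1) ⊕ (Fin k × Fin l)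

/-- The edges of the model, directed away from the root. -/
inductive BroomStep (k l : ℕ) : BroomVertex k l → BroomVertex k l → Prop
  | path (i j : Fin (k + 1)) : (j : ℕ) = i + 1 → BroomStep k l (Sum.inl i) (Sum.inl j)
  | fork (b : Fin k) (d : Fin l) : (d : ℕ) = 0 →
      BroomStep k l (Sum.inl (Fin.last k)) (Sum.inr (b, d))
  | branch (b : Fin k) (d e : Fin l) : (e : ℕ) = d + 1 →
      BroomStep k l (Sum.inr (b, d)) (Sum.inr (b, e))

/-- The path of length `k` from the root, followed by `k` branches of length `l`. -/
def broomGraph (k l : ℕ) : ReflGraph (BroomVertex k l) := ReflGraph.ofStep (BroomStep k l)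

/-! In a word avoiding 12/3, the first repeated letter determines all later ones: a different letter
after it would complete the pattern. A restricted growth function with maximal letter `k < n` is
thus `1 2 ⋯ k b ⋯ b` with `1 ≤ b ≤ k` (`avoidingRGF_eq_broomWord`), and the prefixes form a broom. A
vertex is determined by its depth and the label of its branch, with ε at depth `n + 1`.
`BroomCoords` expresses adjacency and the collapsing maps in these two numbers, so linear arithmetic
treats trees and lattices together.

The decisive property of a collapsing map `f` is `LiftsEdges`: from any `a` and any edge from `f a`
to `d`, a path over `{f a, d}` leads to a point over `d`. A path is needed because collapsed
segments may have to be crossed first. This gives confluence and surjectivity on edges; for fixed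
`k` the fibres are also connected, which gives monotonicity. Folding two branches together destroys
monotonicity.

The index set is countable and directed, with one map per comparable pair, so joint projection and
amalgamation are immediate and the inverse limit is the Fraïssé limit. Compactness turns points and
edges found at all high levels into points and edges of the limit (`exists_thread`,
`exists_adj_of_forall`). For the Kelley property, the components through a thread of the preimages
of a connected set form, by edge lifting, an inverse system with onto maps; its limit is a closed
connected set through the thread that projects onto the given set (`exists_connected_lift`). A
diagonal choice over the countably many indices concludes.

For fixed `k` the maps only truncate branches. Two threads lie on a common chain from the root
downwards or on two different branches. In both cases the segment between them carries at each level
an integer coordinate that the bonding maps preserve weakly, and removing a thread separates what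
comes before it from what comes after (`IsRegular.isArc`). -/

/-! ### Paths in reflexive graphs -/

namespace ReflGraph

variable {V W : Type}

/-- `b` can be reached from `a` along edges between points of `S`. -/
def Reach (G : ReflGraph V) (S : Set V) : V → V → Prop :=
  Relation.ReflTransGen fun x y => G.Adj x y ∧ x ∈ S ∧ y ∈ S

theorem Reach.symm {G : ReflGraph V} {S : Set V} {a b : V} (h : G.Reach S a b) :
    G.Reach S b a := by
  induction h with
  | refl => exact .refl
  | tail _ h ih => exact .head ⟨G.symm _ _ h.1, h.2.2, h.2.1⟩ ih

theorem Reach.trans {G : ReflGraph V} {S : Set V} {a b c : V} (h : G.Reach S a b)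
    (h' : G.Reach S b c) : G.Reach S a c :=
  Relation.ReflTransGen.trans h h'

theorem Reach.mono {G : ReflGraph V} {S T : Set V} (hST : S ⊆ T) {a b : V}
    (h : G.Reach S a b) : G.Reach T a b :=
  Relation.ReflTransGen.mono (fun _ _ h => ⟨h.1, hST h.2.1, hST h.2.2⟩) a b h

theorem Reach.mem {G : ReflGraph V} {S : Set V} {a b : V} (h : G.Reach S a b) (ha : a ∈ S) :
    b ∈ S := by
  induction h with
  | refl => exact ha
  | tail _ h _ => exact h.2.2

/-- A path stays in the set of points reachable from its start. -/
theorem Reach.restrict {G : ReflGraph V} {S : Set V} {a b : V} (h : G.Reach S a b) :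
    G.Reach {c | G.Reach S a c} a b := by
  induction h with
  | refl => exact .refl
  | tail h h' ih => exact ih.tail ⟨h'.1, h, h.tail h'⟩

theorem Reach.map {G : ReflGraph V} {H : ReflGraph W} {f : V → W}
    (hf : ∀ a b, G.Adj a b → H.Adj (f a) (f b)) {S : Set V} {T : Set W}
    (hST : ∀ a ∈ S, f a ∈ T) {a b : V} (h : G.Reach S a b) : H.Reach T (f a) (f b) := by
  induction h with
  | refl => exact .refl
  | tail _ h' ih => exact ih.tail ⟨hf _ _ h'.1, hST _ h'.2.1, hST _ h'.2.2⟩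

theorem isConnectedSet_of_reach [TopologicalSpace V] {G : ReflGraph V} {S : Set V}
    (h : ∀ a ∈ S, ∀ b ∈ S, G.Reach S a b) : G.IsConnectedSet S := by
  rintro ⟨P, Q, ⟨a, ha⟩, ⟨b, hb⟩, rfl, -, -, hPQ⟩
  have key : ∀ c, G.Reach (P ∪ Q) a c → c ∈ P := by
    intro c hc
    induction hc with
    | refl => exact ha
    | tail _ h' ih => exact h'.2.2.resolve_right fun hq => hPQ _ ih _ hq h'.1
  exact hPQ b (key b (h a (Or.inl ha) b (Or.inr hb))) b hb (G.refl b)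

/-- In a discrete space every set is closed, so the points reachable from `a` and the remaining
points of `S` would form a separation. -/
theorem isConnectedSet_iff_reach [TopologicalSpace V] [DiscreteTopology V] {G : ReflGraph V}
    {S : Set V} : G.IsConnectedSet S ↔ ∀ a ∈ S, ∀ b ∈ S, G.Reach S a b := by
  refine ⟨fun h a ha b hb => ?_, isConnectedSet_of_reach⟩
  by_contra hab
  refine h ⟨{c | G.Reach S a c}, {c | c ∈ S ∧ ¬ G.Reach S a c}, ⟨a, .refl⟩, ⟨b, hb, hab⟩, ?_,
    ⟨{c | G.Reach S a c}, isClosed_discrete _, ?_⟩,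
    ⟨{c | ¬ G.Reach S a c}, isClosed_discrete _, ?_⟩, ?_⟩
  · ext c
    simp only [mem_union, Set.mem_ofPred_eq]
    refine ⟨fun h => h.elim (fun h => h.mem ha) fun h => h.1, fun h => ?_⟩
    tauto
  · ext c
    exact ⟨fun h => ⟨h, h.mem ha⟩, fun h => h.1⟩
  · ext c
    exact ⟨fun h => ⟨h.2, h.1⟩, fun h => ⟨h.2, h.1⟩⟩
  · rintro c hc d ⟨hd, hd'⟩ hcd
    exact hd' (hc.tail ⟨hcd, hc.mem ha, hd⟩)

theorem isConnectedSet_reach [TopologicalSpace V] (G : ReflGraph V) (S : Set V) (a : V) :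
    G.IsConnectedSet {c | G.Reach S a c} :=
  isConnectedSet_of_reach fun _ hb _ hc => hb.restrict.symm.trans hc.restrict

/-- A connected subset cannot meet both sides of a separation, so `S` and `T` both lie on the side
of their common point. -/
theorem IsConnectedSet.union [TopologicalSpace V] {G : ReflGraph V} {S T : Set V}
    (hS : G.IsConnectedSet S) (hT : G.IsConnectedSet T) (hST : (S ∩ T).Nonempty) :
    G.IsConnectedSet (S ∪ T) := by
  rintro ⟨P, Q, hP, hQ, hPQ, ⟨C, hC, hPC⟩, ⟨D, hD, hQD⟩, hadj⟩
  have hdisj : ∀ a ∈ P, a ∉ Q := fun a ha hq => hadj a ha a hq (G.refl a)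
  have key : ∀ R : Set V, R ⊆ S ∪ T → G.IsConnectedSet R → R ⊆ P ∨ R ⊆ Q := by
    intro R hR hconn
    by_contra! h
    obtain ⟨⟨a, haR, haP⟩, ⟨b, hbR, hbQ⟩⟩ := And.imp not_subset.1 not_subset.1 h
    rw [← hPQ] at hR
    refine hconn ⟨R ∩ P, R ∩ Q, ⟨b, hbR, (hR hbR).resolve_right hbQ⟩,
      ⟨a, haR, (hR haR).resolve_left haP⟩, ?_, ⟨C, hC, ?_⟩, ⟨D, hD, ?_⟩,
      fun a ha b hb => hadj a ha.2 b hb.2⟩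
    · rw [← inter_union_distrib_left, inter_eq_left.2 hR]
    · ext x
      have := @hR x
      rw [hPQ] at this
      rw [hPC]
      simp only [mem_inter_iff]
      tauto
    · ext x
      have := @hR x
      rw [hPQ] at this
      rw [hQD]
      simp only [mem_inter_iff]
      tauto
  obtain ⟨x, hxS, hxT⟩ := hST
  obtain ⟨p, hp⟩ := hP
  obtain ⟨q, hq⟩ := hQ
  have hp' : p ∈ S ∪ T := hPQ ▸ Or.inl hp
  have hq' : q ∈ S ∪ T := hPQ ▸ Or.inr hq
  rcases key S subset_union_left hS with hS' | hS' <;>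
  rcases key T subset_union_right hT with hT' | hT'
  · exact hdisj q (hq'.elim (@hS' q) (@hT' q)) hq
  · exact hdisj x (hS' hxS) (hT' hxT)
  · exact hdisj x (hT' hxT) (hS' hxS)
  · exact hdisj p hp (hp'.elim (@hS' p) (@hT' p))

/-! ### Edge lifting, confluence and monotonicity -/

/-- Every edge of the target starting at an image point lifts to a path. -/
def LiftsEdges (G : ReflGraph V) (H : ReflGraph W) (f : V → W) : Prop :=
  ∀ a d, H.Adj (f a) d → ∃ a', G.Reach (f ⁻¹' {f a, d}) a a' ∧ f a' = d

theorem LiftsEdges.exists_reach {G : ReflGraph V} {H : ReflGraph W} {f : V → W}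
    (hf : G.LiftsEdges H f) {S : Set W} {a : V} {d : W} (h : H.Reach S (f a) d) :
    ∃ a', G.Reach (f ⁻¹' S) a a' ∧ f a' = d := by
  induction h with
  | refl => exact ⟨a, .refl, rfl⟩
  | tail _ h ih =>
    obtain ⟨b, hab, rfl⟩ := ih
    obtain ⟨c, hbc, rfl⟩ := hf b _ h.1
    refine ⟨c, hab.trans (hbc.mono (preimage_mono ?_)), rfl⟩
    rintro x (rfl | rfl)
    exacts [h.2.1, h.2.2]

/-- Along the lifted path over `{c, d}` some step must change the image; that step is an edge over
the given one. -/
theorem LiftsEdges.edge_surj {G : ReflGraph V} {H : ReflGraph W} {f : V → W}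
    (hf : G.LiftsEdges H f) (hs : Function.Surjective f) {c d : W} (h : H.Adj c d) :
    ∃ a b, G.Adj a b ∧ f a = c ∧ f b = d := by
  obtain ⟨a, rfl⟩ := hs c
  obtain ⟨b, hab, rfl⟩ := hf a d h
  by_contra! hne
  by_cases hc : f a = f b
  · exact hne a a (G.refl a) rfl hc
  have key : ∀ x, G.Reach (f ⁻¹' {f a, f b}) a x → f x = f a := by
    intro x hx
    induction hx with
    | refl => rfl
    | tail _ h ih => exact h.2.2.resolve_right (hne _ _ h.1 ih)
  exact hc (key b hab).symm

/-- Adjoining to a component everything reachable from one of its points within the preimage keeps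
it connected, so by maximality the lifted paths end in the component. -/
theorem LiftsEdges.isConfluent [TopologicalSpace V] [TopologicalSpace W] [DiscreteTopology W]
    {G : ReflGraph V} {H : ReflGraph W} {f : V → W} (hf : G.LiftsEdges H f) :
    G.IsConfluent H f := by
  intro Q _ hQ C hC
  obtain ⟨⟨⟨a, ha⟩, hsub, hconn⟩, hmax⟩ := hC
  refine Subset.antisymm (image_subset_iff.2 hsub) fun d hd => ?_
  obtain ⟨b, hab, rfl⟩ := hf.exists_reach (isConnectedSet_iff_reach.1 hQ (f a) (hsub ha) d hd)
  refine ⟨b, ?_, rfl⟩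
  refine hmax ⟨⟨a, Or.inl ha⟩, union_subset hsub fun x hx => ?_, hconn.union
    (G.isConnectedSet_reach (f ⁻¹' Q) a) ⟨a, ha, .refl⟩⟩ subset_union_left (Or.inr hab)
  exact Reach.mem hx (hsub ha)

theorem LiftsEdges.isMonotone [TopologicalSpace V] [TopologicalSpace W] [DiscreteTopology W]
    {G : ReflGraph V} {H : ReflGraph W} {f : V → W} (hf : G.LiftsEdges H f)
    (hfib : ∀ a b, f a = f b → G.Reach (f ⁻¹' {f a}) a b) : G.IsMonotone H f := by
  intro Q _ hQ
  refine isConnectedSet_of_reach fun a ha b hb => ?_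
  obtain ⟨c, hac, hc⟩ := hf.exists_reach (isConnectedSet_iff_reach.1 hQ (f a) ha (f b) hb)
  refine hac.trans ((hfib c b hc).mono (preimage_mono ?_))
  rintro x rfl
  exact hc ▸ hb

theorem IsArc.symm [TopologicalSpace V] {G : ReflGraph V} {a b : V} {S : Set V}
    (h : G.IsArc a b S) : G.IsArc b a S :=
  ⟨h.ne.symm, h.right_mem, h.left_mem, h.closed, h.connected,
    fun x hx hb ha => h.cut x hx ha hb⟩

end ReflGraph

/-! ### Inverse systems of finite sets -/

/-- In an inverse system of finite sets over a directed index set, an element of one of the sets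
`C j` extends to a thread through all of them, if the bonding maps between these sets are onto. -/
theorem exists_thread {I : Type} [Preorder I] [IsDirectedOrder I] {V : I → Type}
    [∀ i, Finite (V i)] [∀ i, Nonempty (V i)] (f : ∀ {i j : I}, j ≤ i → V i → V j)
    (hid : ∀ i (x : V i), f (le_refl i) x = x)
    (hcomp : ∀ {i j k : I} (h : j ≤ i) (h' : k ≤ j) (x : V i), f h' (f h x) = f (h'.trans h) x)
    (C : ∀ i, Set (V i)) (i₀ : I)
    (hmaps : ∀ j k (h : j ≤ k), i₀ ≤ j → ∀ x ∈ C k, f h x ∈ C j)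
    (honto : ∀ j k (h : j ≤ k), i₀ ≤ j → ∀ c ∈ C j, ∃ d ∈ C k, f h d = c)
    (j₀ : I) (hj₀ : i₀ ≤ j₀) (c : V j₀) (hc : c ∈ C j₀) :
    ∃ y : ∀ i, V i, (∀ i j (h : j ≤ i), f h (y i) = y j) ∧ (∀ j, i₀ ≤ j → y j ∈ C j) ∧
      y j₀ = c := by
  classical
  let top : ∀ i, TopologicalSpace (V i) := fun _ => ⊥
  have disc : ∀ i, DiscreteTopology (V i) := fun _ => ⟨rfl⟩
  -- `T m` asks for coherence below `m` only. These sets are closed in a compact product and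
  -- directed downwards, so it is enough that each is nonempty.
  let T : {m // j₀ ≤ m} → Set (∀ i, V i) := fun m =>
    {y | y j₀ = c ∧ y m ∈ C m ∧ ∀ (j : I) (h : j ≤ m), f h (y m) = y j}
  have hcl : ∀ m, IsClosed (T m) := by
    intro m
    have h : IsClosed {y : ∀ i, V i | ∀ (j : I) (h : j ≤ m), f h (y m) = y j} := ?_
    · exact ((isClosed_discrete {c}).preimage (continuous_apply j₀)).inter
        (((isClosed_discrete (C m)).preimage (continuous_apply (m : I))).inter h)
    simp only [Set.ofPred_forall]
    refine isClosed_iInter fun j => isClosed_iInter fun h => isClosed_eq ?_ (continuous_apply j)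
    exact (continuous_of_discreteTopology (f := f h)).comp (continuous_apply (m : I))
  have hne : Nonempty {m // j₀ ≤ m} := ⟨⟨j₀, le_rfl⟩⟩
  obtain ⟨y, hy⟩ := IsCompact.nonempty_iInter_of_directed_nonempty_isCompact_isClosed T
    (by
      intro m m'
      obtain ⟨l, hl, hl'⟩ := directed_of (· ≤ ·) (m : I) m'
      have key : ∀ m'' : {m // j₀ ≤ m}, (m'' : I) ≤ l → T ⟨l, m.2.trans hl⟩ ⊆ T m'' := by
        rintro ⟨m'', hm''⟩ hle y ⟨h1, h2, h3⟩
        refine ⟨h1, ?_, fun j h => ?_⟩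
        · rw [← h3 m'' hle]
          exact hmaps _ _ _ (hj₀.trans hm'') _ h2
        · rw [← h3 m'' hle, hcomp]
          exact h3 _ _
      exact ⟨⟨l, m.2.trans hl⟩, key m hl, key m' hl'⟩)
    (by
      rintro ⟨m, hm⟩
      obtain ⟨d, hd, rfl⟩ := honto j₀ m hm hj₀ c hc
      -- `T m` does not constrain coordinates that are not below `m`; they get arbitrary values.
      refine ⟨fun j => if h : j ≤ m then f h d else Classical.arbitrary _, ?_, ?_, ?_⟩
      · simp [hm]
      · simp [hid, hd]
      · intro j h
        have h : j ≤ m := h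
        simp [h, hid])
    (fun m => (hcl m).isCompact) hcl
  rw [mem_iInter] at hy
  have hup : ∀ j : I, ∃ m : {m // j₀ ≤ m}, j ≤ m := fun j => by
    obtain ⟨l, hl, hl'⟩ := directed_of (· ≤ ·) j₀ j
    exact ⟨⟨l, hl⟩, hl'⟩
  refine ⟨y, fun i j h => ?_, fun j hj => ?_, (hy ⟨j₀, le_rfl⟩).1⟩
  · obtain ⟨m, hm⟩ := hup i
    rw [← (hy m).2.2 i hm, hcomp]
    exact (hy m).2.2 _ _
  · obtain ⟨m, hm⟩ := hup j
    rw [← (hy m).2.2 j hm]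
    exact hmaps _ _ _ hj _ (hy m).2.1

/-! ### Inverse limits of families with edge-lifting bonding maps -/

namespace BondedFamily

variable {I : Type} [Preorder I] {F : BondedFamily I}

/-- The members are finite and the bonding maps are functorial, edge-lifting rooted
epimorphisms. -/
structure IsRegular (F : BondedFamily I) : Prop where
  finite : ∀ i, Finite (F.V i)
  bond_self : ∀ i (x : F.V i), F.bond (le_refl i) x = x
  bond_bond : ∀ {i j k : I} (h : j ≤ i) (h' : k ≤ j) (x : F.V i),
    F.bond h' (F.bond h x) = F.bond (h'.trans h) x
  isRootedEpi : ∀ {i j : I} (h : j ≤ i),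
    (F.graph i).IsRootedEpi (F.root i) (F.graph j) (F.root j) (F.bond h)
  liftsEdges : ∀ {i j : I} (h : j ≤ i), (F.graph i).LiftsEdges (F.graph j) (F.bond h)

theorem IsRegular.restrict (hF : F.IsRegular) (S : Set I) : (F.restrict S).IsRegular where
  finite i := hF.finite i
  bond_self i := hF.bond_self i
  bond_bond h h' := hF.bond_bond (i := (_ : S)) (j := (_ : S)) (k := (_ : S)) h h'
  isRootedEpi h := hF.isRootedEpi h
  liftsEdges h := hF.liftsEdges h

theorem bond_proj {i j : I} (h : j ≤ i) (x : F.Limit) : F.bond h (F.proj i x) = F.proj j x :=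
  x.2 i j h

theorem continuous_proj (i : I) : Continuous (F.proj i) :=
  (continuous_apply i).comp continuous_subtype_val

theorem Limit.ext {x y : F.Limit} (h : ∀ i, F.proj i x = F.proj i y) : x = y :=
  Subtype.ext (funext h)

theorem isClosed_proj_preimage (i : I) (s : Set (F.V i)) : IsClosed (F.proj i ⁻¹' s) :=
  (isClosed_discrete s).preimage (continuous_proj i)

theorem isOpen_proj_preimage (i : I) (s : Set (F.V i)) : IsOpen (F.proj i ⁻¹' s) :=
  (isOpen_discrete s).preimage (continuous_proj i)

theorem isClosed_setOf_adj (i : I) :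
    IsClosed {e : F.Limit × F.Limit | (F.graph i).Adj (F.proj i e.1) (F.proj i e.2)} :=
  (isClosed_discrete {e : F.V i × F.V i | (F.graph i).Adj e.1 e.2}).preimage
    (((continuous_proj i).comp continuous_fst).prodMk ((continuous_proj i).comp continuous_snd))

theorem compactSpace_limit (hF : ∀ i, Finite (F.V i)) : CompactSpace F.Limit := by
  have h : IsClosed {x : ∀ i, F.V i | ∀ i j (h : j ≤ i), F.bond h (x i) = x j} := by
    simp only [Set.ofPred_forall]
    refine isClosed_iInter fun i => isClosed_iInter fun j => isClosed_iInter fun h =>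
      isClosed_eq ?_ (continuous_apply j)
    exact (continuous_of_discreteTopology (f := F.bond h)).comp (continuous_apply i)
  exact isCompact_iff_compactSpace.1 h.isCompact

theorem t2Space_limit : T2Space F.Limit :=
  inferInstanceAs (T2Space {x : ∀ i, F.V i // ∀ i j (h : j ≤ i), F.bond h (x i) = x j})

theorem isTopologicalGraph_limit [Countable I] (hF : ∀ i, Finite (F.V i)) :
    F.limitGraph.IsTopologicalGraph where
  compact := compactSpace_limit hF
  t2 := t2Space_limit
  zeroDim := by
    have := compactSpace_limit hF
    have := t2Space_limit (F := F)
    have : TotallyDisconnectedSpace F.Limit := inferInstanceAs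
      (TotallyDisconnectedSpace {x : ∀ i, F.V i // ∀ i j (h : j ≤ i), F.bond h (x i) = x j})
    exact isTopologicalBasis_isClopen
  secondCountable := by
    have : ∀ i, SecondCountableTopology (F.V i) := fun i => inferInstance
    have : SecondCountableTopology (∀ i, F.V i) := inferInstance
    exact TopologicalSpace.Subtype.secondCountableTopology
      {x : ∀ i, F.V i | ∀ i j (h : j ≤ i), F.bond h (x i) = x j}
  closed_edges := by
    have h : {e : F.Limit × F.Limit | F.limitGraph.Adj e.1 e.2} =
        ⋂ i, {e | (F.graph i).Adj (F.proj i e.1) (F.proj i e.2)} := by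
      ext e
      simp [limitGraph]
    rw [h]
    exact isClosed_iInter isClosed_setOf_adj

/-- The thread of roots. -/
def rootThread (hF : F.IsRegular) : F.Limit :=
  ⟨F.root, fun _ _ h => (hF.isRootedEpi h).map_root⟩

/-- A system of subsets of the members beyond `i₀` with onto bonding maps. -/
structure IsSubsystem (F : BondedFamily I) (i₀ : I) (C : ∀ i, Set (F.V i)) : Prop where
  maps : ∀ j k (h : j ≤ k), i₀ ≤ j → ∀ x ∈ C k, F.bond h x ∈ C j
  onto : ∀ j k (h : j ≤ k), i₀ ≤ j → ∀ c ∈ C j, ∃ d ∈ C k, F.bond h d = c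

/-- The threads running through a system of subsets. -/
def threads (F : BondedFamily I) (i₀ : I) (C : ∀ i, Set (F.V i)) : Set F.Limit :=
  {y | ∀ j, i₀ ≤ j → F.proj j y ∈ C j}

theorem isClosed_threads (i₀ : I) (C : ∀ i, Set (F.V i)) : IsClosed (F.threads i₀ C) := by
  simp only [threads, Set.ofPred_forall]
  exact isClosed_iInter fun j => isClosed_iInter fun _ => isClosed_proj_preimage j (C j)

theorem IsRegular.isSubsystem_univ (hF : F.IsRegular) (i₀ : I) :
    F.IsSubsystem i₀ fun _ => univ where
  maps _ _ _ _ _ _ := mem_univ _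
  onto _ _ h _ c _ := by
    obtain ⟨d, hd⟩ := (hF.isRootedEpi h).epi.surj c
    exact ⟨d, mem_univ _, hd⟩

theorem bond_comp_proj {i j : I} (h : i ≤ j) : F.bond h ∘ F.proj j = F.proj i :=
  funext (bond_proj h)

theorem proj_mem_limitEpis (i : I) : F.proj i ∈ F.limitEpis i :=
  ⟨i, le_rfl, (bond_comp_proj le_rfl).symm⟩

/-- Coherence of threads leaves a single induced map to each member, so lifting along distinguished
maps reduces to `bond_comp_proj`. -/
theorem eq_proj_of_mem_limitEpis {i : I} {f : F.Limit → F.V i} (hf : f ∈ F.limitEpis i) :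
    f = F.proj i := by
  obtain ⟨j, h, rfl⟩ := hf
  exact bond_comp_proj h

/-! ### Compactness arguments over a directed index set -/

section Directed

variable [IsDirectedOrder I]

/-- A basic open set constrains finitely many coordinates, and one coordinate above them determines
them all. -/
theorem exists_fibre_subset [Nonempty I] {x : F.Limit} {U : Set F.Limit} (hU : IsOpen U)
    (hx : x ∈ U) : ∃ i, ∀ y, F.proj i y = F.proj i x → y ∈ U := by
  classical
  obtain ⟨O, hO, rfl⟩ := isOpen_induced_iff.1 hU
  obtain ⟨J, u, hu, hJ⟩ := isOpen_pi_iff.1 hO x.1 hx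
  obtain ⟨i, hi⟩ := J.exists_le
  refine ⟨i, fun y hy => hJ fun j hj => ?_⟩
  have : F.proj j y = F.proj j x := by
    rw [← bond_proj (hi j hj), ← bond_proj (hi j hj), hy]
  change F.proj j y ∈ u j
  rw [this]
  exact (hu j hj).2

/-- A directed system of pairs of adjacent coordinates yields an edge of the limit. -/
theorem exists_adj_of_forall [Nonempty I] (hF : F.IsRegular) {P Q : Set F.Limit}
    (hP : IsClosed P) (hQ : IsClosed Q) (i₀ : I)
    (h : ∀ i, i₀ ≤ i → ∃ x ∈ P, ∃ y ∈ Q, (F.graph i).Adj (F.proj i x) (F.proj i y)) :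
    ∃ x ∈ P, ∃ y ∈ Q, F.limitGraph.Adj x y := by
  have := compactSpace_limit hF.finite
  let T : {i // i₀ ≤ i} → Set (F.Limit × F.Limit) := fun i =>
    P ×ˢ Q ∩ {e | (F.graph i).Adj (F.proj i e.1) (F.proj i e.2)}
  have hanti : ∀ {i j : I}, j ≤ i → ∀ x y, (F.graph i).Adj (F.proj i x) (F.proj i y) →
      (F.graph j).Adj (F.proj j x) (F.proj j y) := by
    intro i j hij x y hxy
    rw [← bond_proj hij, ← bond_proj hij]
    exact (hF.isRootedEpi hij).epi.hom _ _ hxy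
  have hne : Nonempty {i // i₀ ≤ i} := ⟨⟨i₀, le_rfl⟩⟩
  have hcl : ∀ i, IsClosed (T i) := fun i => (hP.prod hQ).inter (isClosed_setOf_adj (i : I))
  obtain ⟨⟨x, y⟩, hxy⟩ := IsCompact.nonempty_iInter_of_directed_nonempty_isCompact_isClosed T
    (by
      intro i j
      obtain ⟨l, hl, hl'⟩ := directed_of (· ≤ ·) (i : I) j
      exact ⟨⟨l, i.2.trans hl⟩, fun e he => ⟨he.1, hanti hl _ _ he.2⟩,
        fun e he => ⟨he.1, hanti hl' _ _ he.2⟩⟩)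
    (by
      rintro ⟨i, hi⟩
      obtain ⟨x, hx, y, hy, hxy⟩ := h i hi
      exact ⟨(x, y), ⟨hx, hy⟩, hxy⟩)
    (fun i => (hcl i).isCompact) hcl
  rw [mem_iInter] at hxy
  refine ⟨x, (hxy ⟨i₀, le_rfl⟩).1.1, y, (hxy ⟨i₀, le_rfl⟩).1.2, fun i => ?_⟩
  obtain ⟨l, hl, hl'⟩ := directed_of (· ≤ ·) i₀ i
  exact hanti hl' _ _ (hxy ⟨l, hl⟩).2

theorem IsSubsystem.exists_thread (hF : F.IsRegular) {i₀ : I} {C : ∀ i, Set (F.V i)}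
    (hC : F.IsSubsystem i₀ C) {j : I} (hj : i₀ ≤ j) {c : F.V j} (hc : c ∈ C j) :
    ∃ y ∈ F.threads i₀ C, F.proj j y = c := by
  have := hF.finite
  have : ∀ i, Nonempty (F.V i) := fun i => ⟨F.root i⟩
  obtain ⟨y, h1, h2, h3⟩ := _root_.exists_thread F.bond hF.bond_self hF.bond_bond C i₀
    hC.maps hC.onto j hj c hc
  exact ⟨⟨y, h1⟩, h2, h3⟩

/-- The two closed pieces of a separation project onto sets covering `C i`. As `C i` is connected,
an edge joins these projections at every level beyond `i₀`, and compactness gives an edge between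
the pieces. -/
theorem IsSubsystem.isConnectedSet (hF : F.IsRegular) {i₀ : I} {C : ∀ i, Set (F.V i)}
    (hC : F.IsSubsystem i₀ C) (hconn : ∀ i, i₀ ≤ i → (F.graph i).IsConnectedSet (C i)) :
    F.limitGraph.IsConnectedSet (F.threads i₀ C) := by
  have : Nonempty I := ⟨i₀⟩
  rintro ⟨P, Q, hP, hQ, hPQ, ⟨A, hA, hPA⟩, ⟨B, hB, hQB⟩, hadj⟩
  have hP' : IsClosed P := hPA ▸ hA.inter (isClosed_threads i₀ C)
  have hQ' : IsClosed Q := hQB ▸ hB.inter (isClosed_threads i₀ C)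
  suffices h : ∃ x ∈ P, ∃ y ∈ Q, F.limitGraph.Adj x y by
    obtain ⟨x, hx, y, hy, hxy⟩ := h
    exact hadj x hx y hy hxy
  refine exists_adj_of_forall hF hP' hQ' i₀ fun i hi => ?_
  by_contra! hne
  have himg : F.proj i '' P ∪ F.proj i '' Q = C i := by
    rw [← image_union, hPQ]
    refine Subset.antisymm (image_subset_iff.2 fun y hy => hy i hi) fun c hc => ?_
    exact hC.exists_thread hF hi hc
  refine hconn i hi ⟨_, _, hP.image _, hQ.image _, himg, ⟨F.proj i '' P, isClosed_discrete _, ?_⟩,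
    ⟨F.proj i '' Q, isClosed_discrete _, ?_⟩, ?_⟩
  · exact (inter_eq_left.2 (himg ▸ subset_union_left)).symm
  · exact (inter_eq_left.2 (himg ▸ subset_union_right)).symm
  · rintro _ ⟨x, hx, rfl⟩ _ ⟨y, hy, rfl⟩
    exact hne x hx y hy

theorem IsRegular.proj_surjective (hF : F.IsRegular) (i : I) :
    Function.Surjective (F.proj i) := fun c => by
  obtain ⟨y, -, hy⟩ := (hF.isSubsystem_univ i).exists_thread hF le_rfl (mem_univ c)
  exact ⟨y, hy⟩

theorem IsRegular.isRootedEpi_proj [Nonempty I] (hF : F.IsRegular) (i : I) :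
    F.limitGraph.IsRootedEpi (rootThread hF) (F.graph i) (F.root i) (F.proj i) where
  map_root := rfl
  epi :=
    { hom := fun _ _ h => h i
      surj := hF.proj_surjective i
      edge_surj := fun c d hcd => by
        obtain ⟨x, hx, y, hy, hxy⟩ := exists_adj_of_forall hF (isClosed_proj_preimage i {c})
          (isClosed_proj_preimage i {d}) i fun j hj => by
            obtain ⟨a, b, hab, rfl, rfl⟩ := (hF.isRootedEpi hj).epi.edge_surj c d hcd
            obtain ⟨x, rfl⟩ := hF.proj_surjective j a
            obtain ⟨y, rfl⟩ := hF.proj_surjective j b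
            exact ⟨x, (bond_proj hj x).symm, y, (bond_proj hj y).symm, hab⟩
        exact ⟨x, y, hxy, hx, hy⟩ }

/-- With one map per comparable pair and functoriality, every square below a common upper bound
commutes. -/
theorem IsRegular.isProjectiveFraisse [Nonempty I] [Countable I] (hF : F.IsRegular) :
    F.IsProjectiveFraisse where
  nonempty := inferInstance
  finite := hF.finite
  isEpi := by
    rintro i j _ ⟨h, rfl⟩
    exact hF.isRootedEpi h
  countable S _ := S.to_countable
  id_mem i := ⟨le_rfl, funext fun x => (hF.bond_self i x).symm⟩
  comp_mem := by
    rintro i j k _ ⟨h, rfl⟩ _ ⟨h', rfl⟩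
    exact ⟨h'.trans h, funext fun x => hF.bond_bond h h' x⟩
  joint b c := by
    obtain ⟨d, hb, hc⟩ := directed_of (· ≤ ·) b c
    exact ⟨d, _, ⟨hb, rfl⟩, _, ⟨hc, rfl⟩, trivial⟩
  amalgamation := by
    rintro a b c _ ⟨h, rfl⟩ _ ⟨h', rfl⟩
    obtain ⟨d, hb, hc⟩ := directed_of (· ≤ ·) b c
    refine ⟨d, _, ⟨hb, rfl⟩, _, ⟨hc, rfl⟩, funext fun x => ?_⟩
    exact (hF.bond_bond hb h x).trans (hF.bond_bond hc h' x).symm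

theorem IsRegular.isProjectiveFraisseLimit [Nonempty I] [Countable I] (hF : F.IsRegular) :
    F.IsProjectiveFraisseLimit where
  topological := isTopologicalGraph_limit hF.finite
  projective_universality i := ⟨_, proj_mem_limitEpis i⟩
  epi := ⟨rootThread hF, fun i f hf => by
    rw [eq_proj_of_mem_limitEpis hf]
    exact ⟨continuous_proj i, hF.isRootedEpi_proj i⟩⟩
  lift := by
    rintro i j f hf _ ⟨h, rfl⟩
    exact ⟨_, proj_mem_limitEpis j, by rw [eq_proj_of_mem_limitEpis hf, bond_comp_proj]⟩
  refine_cover := by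
    classical
    intro 𝒰 hopen hcover
    have := compactSpace_limit hF.finite
    have hx : ∀ x : F.Limit, ∃ i, ∃ U ∈ 𝒰, ∀ y, F.proj i y = F.proj i x → y ∈ U := by
      intro x
      obtain ⟨U, hU, hxU⟩ : x ∈ ⋃₀ 𝒰 := hcover ▸ mem_univ x
      obtain ⟨i, hi⟩ := exists_fibre_subset (hopen U hU) hxU
      exact ⟨i, U, hU, hi⟩
    choose i U hU hi using hx
    obtain ⟨t, ht⟩ := isCompact_univ.elim_finite_subcover
      (fun x : F.Limit => F.proj (i x) ⁻¹' {F.proj (i x) x})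
      (fun x => isOpen_proj_preimage _ _) (fun x _ => mem_iUnion.2 ⟨x, rfl⟩)
    -- Finitely many fibres subordinate to the cover suffice; at a level above theirs, each fibre
    -- lies inside one of them.
    obtain ⟨m, hm⟩ := (t.image i).exists_le
    refine ⟨m, _, proj_mem_limitEpis m, fun v => ?_⟩
    obtain ⟨z, rfl⟩ := hF.proj_surjective m v
    obtain ⟨x, hxt, hzx⟩ := mem_iUnion₂.1 (ht (mem_univ z))
    refine ⟨U x, hU x, fun y hy => hi x y ?_⟩
    have hle := hm _ (Finset.mem_image_of_mem i hxt)
    rw [← show F.proj (i x) z = F.proj (i x) x from hzx, ← bond_proj hle, ← bond_proj hle,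
      show F.proj m y = F.proj m z from hy]

/-! ### The Kelley property -/

/-- Through each point over a connected set `Q` passes a closed connected set that maps
onto `Q`. -/
theorem IsRegular.exists_connected_lift (hF : F.IsRegular) {i : I} {Q : Set (F.V i)}
    (hQ : (F.graph i).IsConnectedSet Q) {x : F.Limit} (hx : F.proj i x ∈ Q) :
    ∃ L : Set F.Limit, IsClosed L ∧ F.limitGraph.IsConnectedSet L ∧ x ∈ L ∧
      F.proj i '' L = Q := by
  -- Vacuous unless `i ≤ j`; only those levels matter.
  let S : ∀ j, Set (F.V j) := fun j => {v | ∀ h : i ≤ j, F.bond h v ∈ Q}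
  have hS : ∀ {j k} (h : j ≤ k), i ≤ j → F.bond h ⁻¹' S j = S k := by
    intro j k h hij
    ext v
    simp only [S, mem_preimage, Set.mem_ofPred_eq, hF.bond_bond]
    exact ⟨fun h' _ => h' hij, fun h' _ => h' (hij.trans h)⟩
  -- The component of the coordinate of `x` in the preimage of `Q`. Edge lifting makes the bonding
  -- maps between these components onto.
  let C : ∀ j, Set (F.V j) := fun j => {v | (F.graph j).Reach (S j) (F.proj j x) v}
  have hxS : ∀ j, F.proj j x ∈ S j := fun j h => by rwa [bond_proj]
  have hC : F.IsSubsystem i C :=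
    { maps := fun j k h hij v hv => by
        have := ReflGraph.Reach.map (hF.isRootedEpi h).epi.hom
          (T := S j) (fun a ha => by rwa [← hS h hij] at ha) hv
        rwa [bond_proj] at this
      onto := fun j k h hij c hc => by
        have hc' : (F.graph j).Reach (S j) (F.bond h (F.proj k x)) c := by rwa [bond_proj]
        obtain ⟨d, hd, rfl⟩ := (hF.liftsEdges h).exists_reach hc'
        rw [hS h hij] at hd
        exact ⟨d, hd, rfl⟩ }
  have hSi : S i = Q := by
    ext v
    simp only [S, Set.mem_ofPred_eq, hF.bond_self]
    exact ⟨fun h => h le_rfl, fun h _ => h⟩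
  have hCi : C i = Q := by
    ext v
    refine ⟨fun h => hSi ▸ ReflGraph.Reach.mem h (hxS i), fun h => ?_⟩
    simp only [C, Set.mem_ofPred_eq, hSi]
    exact ReflGraph.isConnectedSet_iff_reach.1 hQ _ hx _ h
  refine ⟨F.threads i C, isClosed_threads i C,
    hC.isConnectedSet hF fun j _ => ReflGraph.isConnectedSet_reach _ _ _, fun j _ => .refl, ?_⟩
  refine Subset.antisymm (image_subset_iff.2 fun y hy => ?_) fun c hc => ?_
  · rw [← hCi]
    exact hy i le_rfl
  · rw [← hCi] at hc
    exact hC.exists_thread hF le_rfl hc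

theorem _root_.ReflGraph.IsConnectedSet.image_of_hom {V W : Type} [TopologicalSpace V]
    [TopologicalSpace W] {G : ReflGraph V} {H : ReflGraph W} {f : V → W} (hf : Continuous f)
    (hhom : ∀ a b, G.Adj a b → H.Adj (f a) (f b)) {S : Set V} (hS : G.IsConnectedSet S) :
    H.IsConnectedSet (f '' S) := by
  rintro ⟨P, Q, ⟨p, hp⟩, ⟨q, hq⟩, hPQ, ⟨C, hC, hPC⟩, ⟨D, hD, hQD⟩, hadj⟩
  have hmem : ∀ x ∈ S, f x ∈ P ∪ Q := fun x hx => hPQ ▸ mem_image_of_mem f hx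
  obtain ⟨a, ha, rfl⟩ : p ∈ f '' S := hPQ ▸ Or.inl hp
  obtain ⟨b, hb, rfl⟩ : q ∈ f '' S := hPQ ▸ Or.inr hq
  refine hS ⟨f ⁻¹' P ∩ S, f ⁻¹' Q ∩ S, ⟨a, hp, ha⟩, ⟨b, hq, hb⟩, ?_,
    ⟨f ⁻¹' C, hC.preimage hf, ?_⟩, ⟨f ⁻¹' D, hD.preimage hf, ?_⟩,
    fun x hx y hy hxy => hadj _ hx.1 _ hy.1 (hhom x y hxy)⟩
  · rw [← union_inter_distrib_right, inter_eq_right]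
    exact hmem
  · ext x
    simp only [hPC, mem_inter_iff, mem_preimage]
    exact ⟨fun h => ⟨h.1.1, h.2⟩, fun h => ⟨⟨h.1, mem_image_of_mem f h.2⟩, h.2⟩⟩
  · ext x
    simp only [hQD, mem_inter_iff, mem_preimage]
    exact ⟨fun h => ⟨h.1.1, h.2⟩, fun h => ⟨⟨h.1, mem_image_of_mem f h.2⟩, h.2⟩⟩

/-- A sequence of closed sets converges if each projection is eventually constant. -/
theorem tendsto_nonemptyCompacts [Nonempty I] (hF : F.IsRegular) {L : ℕ → NonemptyCompacts F.Limit}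
    {K : NonemptyCompacts F.Limit}
    (h : ∀ i, ∀ᶠ n in atTop, F.proj i '' (L n : Set F.Limit) = F.proj i '' (K : Set F.Limit)) :
    Tendsto L atTop (𝓝 K) := by
  classical
  let top : TopologicalSpace (Set F.Limit) := TopologicalSpace.vietoris F.Limit
  rw [NonemptyCompacts.isEmbedding_coe.tendsto_nhds_iff]
  have := compactSpace_limit hF.finite
  refine tendsto_nhds_generateFrom_iff.2 ?_
  -- Two kinds of subbasic Vietoris sets: the sets contained in `U`, where compactness of `K` yields
  -- one level that suffices, and the sets meeting `U`, where the fibre through one point suffices.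
  rintro s (⟨U, hU, rfl⟩ | ⟨U, hU, rfl⟩) hK
  · have hK : (K : Set F.Limit) ⊆ U := hK
    have hx : ∀ x : F.Limit, ∃ i, x ∈ K → ∀ y, F.proj i y = F.proj i x → y ∈ U := by
      intro x
      by_cases hx : x ∈ K
      · obtain ⟨i, hi⟩ := exists_fibre_subset hU (hK hx)
        exact ⟨i, fun _ => hi⟩
      · exact ⟨Classical.arbitrary I, fun h => absurd h hx⟩
    choose i hi using hx
    obtain ⟨t, htK, ht⟩ := K.isCompact.elim_nhds_subcover
      (fun x => F.proj (i x) ⁻¹' {F.proj (i x) x})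
      (fun x _ => (isOpen_proj_preimage _ _).mem_nhds rfl)
    obtain ⟨m, hm⟩ := (t.image i).exists_le
    filter_upwards [h m] with n hn y hy
    obtain ⟨z, hz, hzy⟩ : F.proj m y ∈ F.proj m '' (K : Set F.Limit) :=
      hn ▸ mem_image_of_mem _ hy
    obtain ⟨x, hxt, hzx⟩ := mem_iUnion₂.1 (ht hz)
    refine hi x (htK x hxt) y ?_
    have hle := hm _ (Finset.mem_image_of_mem i hxt)
    rw [← show F.proj (i x) z = F.proj (i x) x from hzx, ← bond_proj hle, ← bond_proj hle, hzy]
  · obtain ⟨x, hxK, hxU⟩ := hK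
    obtain ⟨i, hi⟩ := exists_fibre_subset hU hxU
    filter_upwards [h i] with n hn
    obtain ⟨y, hy, hyx⟩ : F.proj i x ∈ F.proj i '' (L n : Set F.Limit) :=
      hn ▸ mem_image_of_mem _ hxK
    exact ⟨y, hy, hi y hyx⟩

/-- Diagonal choice of a sequence. -/
theorem exists_diagonal {α : Type} {P : ℕ → α → Prop} {Q : ℕ → ℕ → α → Prop}
    (h0 : ∀ n, ∃ a, P n a) (hQ : ∀ m m' n a, m ≤ m' → Q m' n a → Q m n a)
    (h : ∀ m, ∀ᶠ n in atTop, ∃ a, P n a ∧ Q m n a) :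
    ∃ L : ℕ → α, (∀ n, P n (L n)) ∧ ∀ m, ∀ᶠ n in atTop, Q m n (L n) := by
  classical
  have key : ∀ n, ∃ a, P n a ∧ ∀ m ≤ n, (∃ a, P n a ∧ Q m n a) → Q m n a := by
    intro n
    by_cases hex : ∃ m ≤ n, ∃ a, P n a ∧ Q m n a
    · obtain ⟨m, hm, a, ha⟩ := hex
      -- The best attainable precision up to `n` is taken; `hQ` passes it on to all smaller ones.
      obtain ⟨b, hb⟩ := Nat.findGreatest_spec (P := fun m => ∃ a, P n a ∧ Q m n a) hm ⟨a, ha⟩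
      exact ⟨b, hb.1, fun m' hm' h' => hQ _ _ _ _ (Nat.le_findGreatest hm' h') hb.2⟩
    · obtain ⟨a, ha⟩ := h0 n
      exact ⟨a, ha, fun m hm h' => absurd ⟨m, hm, h'⟩ hex⟩
  choose L hL using key
  refine ⟨L, fun n => (hL n).1, fun m => ?_⟩
  filter_upwards [h m, eventually_ge_atTop m] with n hn hmn
  exact (hL n).2 m hmn hn

/-- Once `x n` agrees with `p` at a level above `e 0, …, e m`, the projection of `K` to that level
lifts to a connected set through `x n`, which then has the same projections as `K` at these indices.
The singleton `{x n}` ensures that some choice exists for every `n`. -/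
theorem IsRegular.isKelley [Nonempty I] [Countable I] (hF : F.IsRegular)
    (hconn : ∀ i, (F.graph i).IsConnectedSet univ) : F.limitGraph.IsKelley := by
  have := compactSpace_limit hF.finite
  have := t2Space_limit (F := F)
  constructor
  · have h := (hF.isSubsystem_univ (Classical.arbitrary I)).isConnectedSet hF fun i _ => hconn i
    convert h
    exact (eq_univ_of_forall fun y _ _ => mem_univ _).symm
  · classical
    intro K hK p hp x hx
    obtain ⟨e, he⟩ := exists_surjective_nat I
    obtain ⟨L, hL, hL'⟩ := exists_diagonal (α := NonemptyCompacts F.Limit)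
      (P := fun n L => F.limitGraph.IsConnectedSet (L : Set F.Limit) ∧ x n ∈ L)
      (Q := fun m _ L => ∀ j ≤ m,
        F.proj (e j) '' (L : Set F.Limit) = F.proj (e j) '' (K : Set F.Limit))
      (fun n => ⟨{x n}, by
        refine ⟨ReflGraph.isConnectedSet_of_reach ?_, rfl⟩
        rintro a (rfl : a = x n) b (rfl : b = x n)
        exact .refl⟩)
      (fun m m' n a h h' j hj => h' j (hj.trans h))
      (fun m => by
        obtain ⟨i, hi⟩ := ((Finset.range (m + 1)).image e).exists_le
        have hev : ∀ᶠ n in atTop, F.proj i (x n) = F.proj i p :=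
          hx.eventually ((isOpen_proj_preimage i {F.proj i p}).mem_nhds rfl)
        filter_upwards [hev] with n hn
        obtain ⟨L, hLc, hLconn, hxL, hLK⟩ := hF.exists_connected_lift (i := i) (x := x n)
          (hK.image_of_hom (continuous_proj i) fun _ _ (h : F.limitGraph.Adj _ _) => h i) (hn ▸ mem_image_of_mem _ hp)
        refine ⟨⟨⟨L, hLc.isCompact⟩, ⟨x n, hxL⟩⟩, ⟨hLconn, hxL⟩, fun j hj => ?_⟩
        have hle := hi _ (Finset.mem_image_of_mem e (Finset.mem_range_succ_iff.2 hj))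
        rw [← bond_comp_proj hle, image_comp, image_comp, ← hLK]
        rfl)
    refine ⟨L, hL, tendsto_nonemptyCompacts hF fun i => ?_⟩
    obtain ⟨m, rfl⟩ := he i
    filter_upwards [hL' m] with n hn
    exact hn m le_rfl

/-! ### Arcs from linear coordinates -/

/-- Threads through connected sets on which the bonding maps are monotone for linear
coordinates `τ` form an arc. -/
theorem IsRegular.isArc (hF : F.IsRegular) {C : ∀ i, Set (F.V i)} {τ : ∀ i, F.V i → ℤ} {i₀ : I}
    (hC : ∀ i, F.IsSubsystem i C) (hconn : ∀ i, (F.graph i).IsConnectedSet (C i))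
    (hinj : ∀ i, ∀ u ∈ C i, ∀ v ∈ C i, τ i u = τ i v → u = v)
    (hadj : ∀ i, ∀ u ∈ C i, ∀ v ∈ C i, (F.graph i).Adj u v → τ i v ≤ τ i u + 1)
    (hmono : ∀ i j (h : j ≤ i), ∀ u ∈ C i, ∀ v ∈ C i, τ i u ≤ τ i v →
      τ j (F.bond h u) ≤ τ j (F.bond h v))
    {a b : F.Limit} (hab : a ≠ b) (ha : ∀ i, F.proj i a ∈ C i) (hb : ∀ i, F.proj i b ∈ C i)
    (hτ : ∀ i, ∀ u ∈ C i, τ i (F.proj i a) ≤ τ i u ∧ τ i u ≤ τ i (F.proj i b)) :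
    F.limitGraph.IsArc a b (F.threads i₀ C) := by
  have hmem : ∀ y ∈ F.threads i₀ C, ∀ i, F.proj i y ∈ C i := by
    intro y hy i
    obtain ⟨l, hl, hl'⟩ := directed_of (· ≤ ·) i₀ i
    rw [← bond_proj hl']
    exact (hC i).maps _ _ hl' le_rfl _ (hy l hl)
  -- Bonding maps preserve weak order, so a strict inequality persists at all higher levels.
  have hmono' : ∀ x ∈ F.threads i₀ C, ∀ y ∈ F.threads i₀ C, ∀ i j, j ≤ i →
      τ j (F.proj j x) < τ j (F.proj j y) → τ i (F.proj i x) < τ i (F.proj i y) := by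
    intro x hx y hy i j hij hlt
    by_contra! hle
    have := hmono i j hij _ (hmem y hy i) _ (hmem x hx i) hle
    rw [bond_proj, bond_proj] at this
    omega
  refine ⟨hab, fun i _ => ha i, fun i _ => hb i, isClosed_threads i₀ C,
    (hC i₀).isConnectedSet hF fun i _ => hconn i, fun x hx hxa hxb hx' => ?_⟩
  have hcl : ∀ i (s : Set (F.V i)), IsClosed {y | F.proj i y ∈ s} := isClosed_proj_preimage
  have hne : ∀ y ∈ F.threads i₀ C, y ≠ x → ∃ i, τ i (F.proj i y) ≠ τ i (F.proj i x) := by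
    intro y hy hyx
    by_contra! h
    exact hyx (Limit.ext fun i => hinj i _ (hmem y hy i) _ (hmem x hx i) (h i))
  -- The separation: threads before `x` in all coordinates, and threads after `x` in all
  -- coordinates.
  refine hx' ⟨{y | ∀ i, τ i (F.proj i y) ≤ τ i (F.proj i x)} ∩ (F.threads i₀ C \ {x}),
    {y | ∀ i, τ i (F.proj i x) ≤ τ i (F.proj i y)} ∩ (F.threads i₀ C \ {x}),
    ⟨a, fun i => (hτ i _ (hmem x hx i)).1, fun i _ => ha i, hxa.symm⟩,
    ⟨b, fun i => (hτ i _ (hmem x hx i)).2, fun i _ => hb i, hxb.symm⟩, ?_,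
    ⟨_, ?_, rfl⟩, ⟨_, ?_, rfl⟩, ?_⟩
  · rw [← union_inter_distrib_right, inter_eq_right]
    rintro y ⟨hy, hyx⟩
    by_contra hcon
    simp only [mem_union, Set.mem_ofPred_eq, not_or, not_forall, not_le] at hcon
    obtain ⟨⟨i, hi⟩, j, hj⟩ := hcon
    obtain ⟨l, hl, hl'⟩ := directed_of (· ≤ ·) i j
    have h1 := hmono' x hx y hy l i hl hi
    have h2 := hmono' y hy x hx l j hl' hj
    omega
  · simp only [Set.ofPred_forall]
    exact isClosed_iInter fun i => hcl i {v | τ i v ≤ τ i (F.proj i x)}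
  · simp only [Set.ofPred_forall]
    exact isClosed_iInter fun i => hcl i {v | τ i (F.proj i x) ≤ τ i v}
  -- At a common upper level `y` is strictly before `x` and `z` strictly after, so their integer
  -- coordinates differ by at least 2, while an edge allows 1.
  · rintro y ⟨hyx, hy, hyne⟩ z ⟨hxz, hz, hzne⟩ hyz
    obtain ⟨i, hi⟩ := hne y hy hyne
    obtain ⟨j, hj⟩ := hne z hz hzne
    obtain ⟨l, hl, hl'⟩ := directed_of (· ≤ ·) i j
    have h1 := hmono' y hy x hx l i hl (lt_of_le_of_ne (hyx i) hi)
    have h2 := hmono' x hx z hz l j hl' (lt_of_le_of_ne (hxz j) hj.symm)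
    have h3 := hadj l _ (hmem y hy l) _ (hmem z hz l) (hyz l)
    omega

end Directed

end BondedFamily

/-! ### Families of brooms in coordinates -/

/-- Coordinates for a family of brooms (`l = 0`), or of brooms with a bottom vertex joined to the
ends of the branches (`l = 1`): the depth `len` of a vertex, and the label `lab` of its branch,
which is `1` off the branches. -/
structure BroomCoords (F : BondedFamily RIndex) (l : ℕ) where
  len : ∀ {p}, F.V p → ℕ
  lab : ∀ {p}, F.V p → ℕ
  le_one : l ≤ 1
  len_le : ∀ {p} (u : F.V p), len u ≤ p.n + l
  lab_pos : ∀ {p} (u : F.V p), 1 ≤ lab u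
  lab_le : ∀ {p} (u : F.V p), lab u ≤ p.k
  lab_eq_one : ∀ {p} (u : F.V p), len u ≤ p.k ∨ p.n < len u → lab u = 1
  ext : ∀ {p} (u v : F.V p), len u = len v → lab u = lab v → u = v
  exists_eq : ∀ (p : RIndex) (s b : ℕ), s ≤ p.n + l → 1 ≤ b → b ≤ p.k →
    ∃ u : F.V p, len u = s ∧ (p.k < s → s ≤ p.n → lab u = b)
  adj_iff : ∀ {p} (u v : F.V p), (F.graph p).Adj u v ↔ len u ≤ len v + 1 ∧ len v ≤ len u + 1 ∧
    (lab u = lab v ∨ len u ≤ p.k ∨ len v ≤ p.k ∨ p.n < len u ∨ p.n < len v)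
  len_root : ∀ p, len (F.root p) = 0
  len_bond_path : ∀ {p q} (h : q ≤ p) (u : F.V p), len u ≤ p.k →
    len (F.bond h u) = len u - (p.k - q.k)
  len_bond_branch : ∀ {p q} (h : q ≤ p) (u : F.V p), p.k < len u → len u ≤ p.n →
    len (F.bond h u) = q.k + min (len u - p.k) (q.n - q.k)
  len_bond_bot : ∀ {p q} (h : q ≤ p) (u : F.V p), p.n < len u → len (F.bond h u) = q.n + 1
  lab_bond : ∀ {p q} (h : q ≤ p) (u : F.V p), p.k < len u → len u ≤ p.n →
    lab (F.bond h u) = if lab u ≤ q.k then lab u else 1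

namespace BroomCoords

variable {F : BondedFamily RIndex} {l : ℕ} (B : BroomCoords F l)
include B

theorem bounds {p : RIndex} (u : F.V p) : B.len u ≤ p.n + l ∧ l ≤ 1 ∧ 1 ≤ B.lab u ∧
    B.lab u ≤ p.k ∧ 1 ≤ p.k ∧ p.k < p.n ∧ (B.len u ≤ p.k ∨ p.n < B.len u → B.lab u = 1) :=
  ⟨B.len_le u, B.le_one, B.lab_pos u, B.lab_le u, p.pos, p.lt, B.lab_eq_one u⟩

/-- Path, branches and bottom in one disjunction about numbers, in the form that `omega` can use. -/
theorem bond_cases {p q : RIndex} (h : q ≤ p) (u : F.V p) :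
    (B.len u ≤ p.k ∧ B.len (F.bond h u) = B.len u - (p.k - q.k) ∧ B.lab (F.bond h u) = 1) ∨
    (p.k < B.len u ∧ B.len u ≤ p.n ∧
      B.len (F.bond h u) = q.k + min (B.len u - p.k) (q.n - q.k) ∧
      (B.lab u ≤ q.k ∧ B.lab (F.bond h u) = B.lab u ∨
        q.k < B.lab u ∧ B.lab (F.bond h u) = 1)) ∨
    (p.n < B.len u ∧ B.len u = p.n + 1 ∧ B.len (F.bond h u) = q.n + 1 ∧
      B.lab (F.bond h u) = 1) := by
  have hk := h.2.1
  have hb := B.bounds u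
  rcases le_or_gt (B.len u) p.k with h1 | h1
  · have h2 := B.len_bond_path h u h1
    exact Or.inl ⟨h1, h2, B.lab_eq_one _ (Or.inl (by omega))⟩
  · rcases le_or_gt (B.len u) p.n with h2 | h2
    · have h3 := B.lab_bond h u h1 h2
      refine Or.inr (Or.inl ⟨h1, h2, B.len_bond_branch h u h1 h2, ?_⟩)
      split_ifs at h3 <;> omega
    · have h3 := B.len_bond_bot h u h2
      exact Or.inr (Or.inr ⟨h2, by omega, h3, B.lab_eq_one _ (Or.inr (by omega))⟩)

theorem finite (p : RIndex) : Finite (F.V p) := by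
  refine Finite.of_injective (β := Fin (p.n + l + 1) × Fin (p.k + 1))
    (fun u => (⟨B.len u, Nat.lt_succ_of_le (B.len_le u)⟩,
      ⟨B.lab u, Nat.lt_succ_of_le (B.lab_le u)⟩)) fun u v huv => ?_
  simp only [Prod.mk.injEq, Fin.mk.injEq] at huv
  exact B.ext u v huv.1 huv.2

/-- The vertices on the branch with label `β`, on the initial path, or at the bottom. -/
def OnChain (β : ℕ) {p : RIndex} (u : F.V p) : Prop :=
  B.len u ≤ p.k ∨ p.n < B.len u ∨ B.lab u = β

theorem reach_of_onChain {p : RIndex} {β : ℕ} (hβ : 1 ≤ β) (hβk : β ≤ p.k) {S : Set (F.V p)}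
    {v : F.V p} (hv : B.OnChain β v) (u : F.V p) (hu : B.OnChain β u) (huv : B.len u ≤ B.len v)
    (hS : ∀ w, B.OnChain β w → B.len u ≤ B.len w → B.len w ≤ B.len v → w ∈ S) :
    (F.graph p).Reach S u v := by
  obtain ⟨d, hd⟩ := Nat.exists_eq_add_of_le huv
  have hbv := B.bounds v
  simp only [OnChain] at hv hu hS
  induction d generalizing u with
  | zero =>
    have hbu := B.bounds u
    rw [B.ext u v (by omega) (by omega)]
    exact .refl
  | succ d ih =>
    have hbu := B.bounds u
    obtain ⟨w, hw, hwb⟩ := B.exists_eq p (B.len u + 1) β (by omega) hβ hβk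
    have hwc : B.len w ≤ p.k ∨ p.n < B.len w ∨ B.lab w = β := by omega
    refine .head ⟨(B.adj_iff u w).2 (by omega), hS u hu le_rfl huv,
      hS w hwc (by omega) (by omega)⟩ (ih w hwc (by omega) (fun x hx hx' => hS x hx (by omega))
        (by omega))

theorem reach_univ {p : RIndex} (u v : F.V p) : (F.graph p).Reach univ u v := by
  have key : ∀ u, (F.graph p).Reach univ (F.root p) u := fun u => by
    refine B.reach_of_onChain (B.lab_pos u) (B.lab_le u) (Or.inr (Or.inr rfl)) _ (Or.inl ?_) ?_
      fun _ _ _ _ => mem_univ _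
    · rw [B.len_root]
      exact Nat.zero_le _
    · rw [B.len_root]
      exact Nat.zero_le _
  exact (key u).symm.trans (key v)

theorem bond_surjective {p q : RIndex} (h : q ≤ p) : Function.Surjective (F.bond h) := by
  intro d
  have h1 := h.1
  have h2 := h.2.1
  have h3 := h.2.2
  have hd := B.bounds d
  have hp := p.lt
  -- On the path the shift is undone; on a branch the depth below the fork is kept; the bottom comes
  -- from the bottom.
  obtain ⟨a, ha, hab⟩ := B.exists_eq p (if B.len d ≤ q.k then B.len d + (p.k - q.k) else
    if B.len d ≤ q.n then p.k + (B.len d - q.k) else p.n + 1) (B.lab d)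
    (by split_ifs <;> omega) (by omega) (by omega)
  refine ⟨a, ?_⟩
  have hc := B.bond_cases h a
  split_ifs at ha hab <;> exact B.ext _ _ (by omega) (by omega)

theorem bond_hom {p q : RIndex} (h : q ≤ p) (u v : F.V p) (huv : (F.graph p).Adj u v) :
    (F.graph q).Adj (F.bond h u) (F.bond h v) := by
  rw [B.adj_iff] at huv ⊢
  have h1 := h.1
  have h2 := h.2.1
  have h3 := h.2.2
  have hu := B.bounds u
  have hv := B.bounds v
  have hq := q.lt
  rcases B.bond_cases h u with hcu | hcu | hcu <;> rcases B.bond_cases h v with hcv | hcv | hcv <;>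
    omega

/-- A chain over an edge of the target. -/
theorem exists_lift {p q : RIndex} (h : q ≤ p) (a : F.V p) (d : F.V q) (s β : ℕ)
    (hs : s ≤ p.n + l) (hβ : 1 ≤ β) (hβk : β ≤ p.k) (ha : B.OnChain β a)
    (hd : ∀ w, B.OnChain β w → B.len w = s →
      B.len (F.bond h w) = B.len d ∧ B.lab (F.bond h w) = B.lab d)
    (hmem : ∀ w, B.OnChain β w → (B.len a ≤ B.len w ∧ B.len w ≤ s ∨
      s ≤ B.len w ∧ B.len w ≤ B.len a) →
      (B.len (F.bond h w) = B.len (F.bond h a) ∧ B.lab (F.bond h w) = B.lab (F.bond h a)) ∨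
      (B.len (F.bond h w) = B.len d ∧ B.lab (F.bond h w) = B.lab d)) :
    ∃ a', (F.graph p).Reach (F.bond h ⁻¹' {F.bond h a, d}) a a' ∧ F.bond h a' = d := by
  obtain ⟨a', rfl, hab'⟩ := B.exists_eq p s β hs hβ hβk
  have hchain' : B.OnChain β a' := by
    simp only [OnChain]
    omega
  have hmem' : ∀ w, B.OnChain β w → (B.len a ≤ B.len w ∧ B.len w ≤ B.len a' ∨
      B.len a' ≤ B.len w ∧ B.len w ≤ B.len a) → w ∈ F.bond h ⁻¹' {F.bond h a, d} := by
    intro w hw hle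
    rcases hmem w hw hle with hw | hw
    · exact Or.inl (B.ext _ _ hw.1 hw.2)
    · exact Or.inr (B.ext _ _ hw.1 hw.2)
  refine ⟨a', ?_, B.ext _ _ (hd a' hchain' rfl).1 (hd a' hchain' rfl).2⟩
  rcases le_total (B.len a) (B.len a') with hle | hle
  · exact B.reach_of_onChain hβ hβk hchain' a ha hle
      fun w hw h1 h2 => hmem' w hw (Or.inl ⟨h1, h2⟩)
  · exact (B.reach_of_onChain hβ hβk ha a' hchain' hle
      fun w hw h1 h2 => hmem' w hw (Or.inr ⟨h1, h2⟩)).symm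

/-- The lifted path runs along one chain: that of the branch of `a` if `a` lies on a branch, even
one folded onto branch 1, and that of the label of `d` when a branch is entered from the fork or
from the bottom. Collapsed segments crossed on the way lie over the image of `a`. -/
theorem bond_liftsEdges {p q : RIndex} (h : q ≤ p) :
    (F.graph p).LiftsEdges (F.graph q) (F.bond h) := by
  intro a d hadj
  rw [B.adj_iff] at hadj
  have h1 := h.1
  have h2 := h.2.1
  have h3 := h.2.2
  have hd := B.bounds d
  have ha := B.bounds a
  have hc := B.bounds (F.bond h a)
  have hw : ∀ w : F.V p, _ := fun w => And.intro (B.bounds w) (B.bond_cases h w)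
  by_cases hcd : B.len (F.bond h a) = B.len d
  · exact ⟨a, .refl, B.ext _ _ hcd (by omega)⟩
  rcases B.bond_cases h a with hca | hca | hca
  · rcases le_or_gt (B.len d) q.k with hdk | hdk
    -- The initial path belongs to every chain, so the label 1 is an arbitrary choice.
    · refine B.exists_lift h a d (B.len d + (p.k - q.k)) 1 (by omega) le_rfl p.pos
        (Or.inl hca.1) (fun w hwc hws => ?_) fun w hwc hle => ?_
      · have := hw w
        omega
      · have hlab := hd.2.2.2.2.2.2 (Or.inl hdk)
        have hlen : B.len w ≤ p.k := by omega
        have hww := B.len_bond_path h w hlen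
        have hwl := B.lab_eq_one (F.bond h w) (Or.inl (by omega))
        rw [hwl, hlab, hca.2.2]
        omega
    · have hlen : B.len a = p.k ∧ B.len d = q.k + 1 := by omega
      refine B.exists_lift h a d (p.k + 1) (B.lab d) (by omega) hd.2.2.1 (by omega)
        (Or.inl hca.1) (fun w hwc hws => ?_) fun w hwc hle => ?_
      · have := hw w
        simp only [OnChain] at hwc
        omega
      · have := hw w
        simp only [OnChain] at hwc
        rcases (by omega : B.len w = p.k ∨ B.len w = p.k + 1) with h4 | h4
        · left
          omega
        · right
          omega
  · have hcn : B.len (F.bond h a) ≤ q.n ∧ q.k < B.len (F.bond h a) := by omega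
    have hβ : B.OnChain (B.lab a) a := Or.inr (Or.inr rfl)
    rcases le_or_gt (B.len d) q.k with hdk | hdk
    · have hlen : B.len (F.bond h a) = q.k + 1 ∧ B.len d = q.k := by omega
      refine B.exists_lift h a d p.k (B.lab a) (by omega) ha.2.2.1 (by omega)
        hβ (fun w hwc hws => ?_) fun w hwc hle => ?_
      · have := hw w
        omega
      · simp only [OnChain] at hwc
        rcases (by omega : B.len w = p.k ∨ p.k < B.len w) with h4 | h4
        · right
          have := hw w
          omega
        · left
          have h5 : B.len w ≤ p.n := by omega
          refine ⟨?_, ?_⟩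
          · have := B.len_bond_branch h w h4 h5
            omega
          · rw [B.lab_bond h w h4 h5, B.lab_bond h a hca.1 hca.2.1,
              show B.lab w = B.lab a by omega]
    · rcases le_or_gt (B.len d) q.n with hdn | hdn
      · have hlab : B.lab (F.bond h a) = B.lab d := by omega
        have key : ∀ w, B.OnChain (B.lab a) w → p.k < B.len w → B.len w ≤ p.n →
            B.len (F.bond h w) = q.k + min (B.len w - p.k) (q.n - q.k) ∧
            B.lab (F.bond h w) = B.lab d := by
          intro w hwc h4 h5
          simp only [OnChain] at hwc
          refine ⟨B.len_bond_branch h w h4 h5, ?_⟩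
          rw [← hlab, B.lab_bond h w h4 h5, B.lab_bond h a hca.1 hca.2.1,
            show B.lab w = B.lab a by omega]
        refine B.exists_lift h a d (p.k + (B.len d - q.k)) (B.lab a) (by omega) ha.2.2.1
          (by omega) hβ (fun w hwc hws => ?_) fun w hwc hle => ?_
        · have := key w hwc (by omega) (by omega)
          omega
        · have := key w hwc (by omega) (by omega)
          rw [this.1, this.2, hlab]
          omega
      · have hlen : q.n - q.k ≤ B.len a - p.k ∧ B.len d = q.n + 1 := by omega
        refine B.exists_lift h a d (p.n + 1) (B.lab a) (by omega) ha.2.2.1 (by omega)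
          hβ (fun w hwc hws => ?_) fun w hwc hle => ?_
        · have := hw w
          omega
        · rcases le_or_gt (B.len w) p.n with h5 | h5
          · simp only [OnChain] at hwc
            have h4 : p.k < B.len w := by omega
            left
            refine ⟨?_, ?_⟩
            · have := B.len_bond_branch h w h4 h5
              omega
            · rw [B.lab_bond h w h4 h5, B.lab_bond h a hca.1 hca.2.1,
                show B.lab w = B.lab a by omega]
          · right
            have := hw w
            omega
  · have hlen : B.len d = q.n := by omega
    have hp := p.lt
    have hq := q.lt
    refine B.exists_lift h a d p.n (B.lab d) (by omega) hd.2.2.1 (by omega)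
      (Or.inr (Or.inl hca.1)) (fun w hwc hws => ?_) fun w hwc hle => ?_
    · have := hw w
      simp only [OnChain] at hwc
      omega
    · have := hw w
      simp only [OnChain] at hwc
      rcases (by omega : B.len w = p.n ∨ B.len w = p.n + 1) with h4 | h4
      · right
        omega
      · left
        omega

/-- Functoriality uses the third condition of the order: it says that the branch length `n - k` does
not grow downwards, so successive truncations combine. Labels combine because `k` does not grow
either and a folded branch goes to label 1, which is never folded again. -/
theorem isRegular : F.IsRegular where
  finite := B.finite
  bond_self p u := by
    have h1 := B.bounds u
    have h2 := B.bond_cases (le_refl p) u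
    exact B.ext _ _ (by omega) (by omega)
  bond_bond {p q r} h h' u := by
    have h1 := h.1
    have h2 := h.2.1
    have h3 := h.2.2
    have h1' := h'.1
    have h2' := h'.2.1
    have h3' := h'.2.2
    have hu := B.bounds u
    have hq := q.lt
    have hr := r.lt
    have hcu := B.bond_cases (h'.trans h) u
    have hcv := B.bond_cases h u
    have hcw := B.bond_cases h' (F.bond h u)
    have : B.len (F.bond h' (F.bond h u)) = B.len (F.bond (h'.trans h) u) ∧
        B.lab (F.bond h' (F.bond h u)) = B.lab (F.bond (h'.trans h) u) := by
      rcases hcu with hcu | hcu | hcu <;> rcases hcv with hcv | hcv | hcv <;>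
        rcases hcw with hcw | hcw | hcw <;> omega
    exact B.ext _ _ this.1 this.2
  isRootedEpi {p q} h :=
    { map_root := by
        have h1 := B.bond_cases h (F.root p)
        have h2 := B.bounds (F.root q)
        have h3 := p.pos
        have h4 := p.lt
        rw [B.len_root] at h1 h2
        exact B.ext _ _ (by rw [B.len_root]; omega) (by omega)
      epi :=
        { hom := B.bond_hom h
          surj := B.bond_surjective h
          edge_surj := fun _ _ => (B.bond_liftsEdges h).edge_surj (B.bond_surjective h) } }
  liftsEdges h := B.bond_liftsEdges h

/-- For equal `k` nothing on the path is collapsed and no branches are identified, so each fibre is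
a point or a final segment of one branch. -/
theorem isMonotone {p q : RIndex} (h : q ≤ p) (hk : p.k = q.k) :
    (F.graph p).IsMonotone (F.graph q) (F.bond h) := by
  refine (B.bond_liftsEdges h).isMonotone ?_
  have key : ∀ a b, F.bond h a = F.bond h b → B.len a ≤ B.len b →
      (F.graph p).Reach (F.bond h ⁻¹' {F.bond h a}) a b := by
    intro a b hab hle
    have h1 := h.1
    have hba := B.bounds a
    have hbb := B.bounds b
    have hca := B.bond_cases h a
    have hcb := B.bond_cases h b
    have hq := q.lt
    have hsub : p.k - q.k = 0 := by omega
    rw [hsub, Nat.sub_zero] at hca hcb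
    rw [← hab] at hcb
    by_cases hlen : B.len a = B.len b
    · rw [B.ext a b hlen (by omega)]
      exact .refl
    have hlab : B.lab a = B.lab b := by omega
    refine B.reach_of_onChain hbb.2.2.1 hbb.2.2.2.1 (Or.inr (Or.inr rfl)) a
      (Or.inr (Or.inr hlab)) hle fun w hw hw1 hw2 => ?_
    simp only [OnChain] at hw
    have hbw := B.bounds w
    have hcw := B.bond_cases h w
    rw [hsub, Nat.sub_zero] at hcw
    exact B.ext _ _ (by omega) (by omega)
  intro a b hab
  rcases le_total (B.len a) (B.len b) with hle | hle
  · exact key a b hab hle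
  · rw [hab]
    exact (key b a hab.symm hle).symm

/-- From `(3, 2)` to `(2, 1)` two branches of length one are folded onto the only branch of the
target. Their end vertices form a fibre with no edge between them; ε, if present, lies outside that
fibre. -/
theorem exists_not_isMonotone :
    ∃ (p q : RIndex) (h : q ≤ p), ¬ (F.graph p).IsMonotone (F.graph q) (F.bond h) := by
  let p : RIndex := ⟨3, 2, by norm_num, by norm_num⟩
  let q : RIndex := ⟨2, 1, le_rfl, by norm_num⟩
  have hpn : p.n = 3 := rfl
  have hpk : p.k = 2 := rfl
  have hqn : q.n = 2 := rfl
  have hqk : q.k = 1 := rfl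
  have h : q ≤ p := ⟨by norm_num [p, q], by norm_num [p, q], by norm_num [p, q]⟩
  refine ⟨p, q, h, fun hmono => ?_⟩
  obtain ⟨a, ha, hab⟩ := B.exists_eq p 3 1 (by omega) (by omega) (by omega)
  obtain ⟨b, hb, hbb⟩ := B.exists_eq p 3 2 (by omega) (by omega) (by omega)
  have hca := B.bond_cases h a
  have hcb := B.bond_cases h b
  have hconn := hmono {F.bond h a} (isClosed_discrete _)
    (ReflGraph.isConnectedSet_of_reach (by
      rintro x (rfl : x = _) y (rfl : y = _)
      exact .refl))
  have hba : F.bond h b = F.bond h a := B.ext _ _ (by omega) (by omega)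
  have hreach := ReflGraph.isConnectedSet_iff_reach.1 hconn a rfl b hba
  have key : ∀ x, (F.graph p).Reach (F.bond h ⁻¹' {F.bond h a}) a x → B.len x = 3 ∧ B.lab x = 1 := by
    intro x hx
    induction hx with
    | refl => exact ⟨ha, hab (by omega) (by omega)⟩
    | @tail y z _ hyz ih =>
      have hz : F.bond h z = F.bond h a := hyz.2.2
      have hadj := (B.adj_iff y z).1 hyz.1
      have hcz := B.bond_cases h z
      rw [hz] at hcz
      omega
  have := key b hreach
  omega

end BroomCoords

/-! ### The index set -/

instance : Countable RIndex :=
  Function.Injective.countable (f := fun p : RIndex => (p.n, p.k)) fun p q h => by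
    simp only [Prod.mk.injEq] at h
    exact RIndex.ext h.1 h.2

instance : Nonempty RIndex := ⟨⟨2, 1, le_rfl, by norm_num⟩⟩

instance : IsDirectedOrder RIndex where
  directed p q := by
    have hp := p.lt
    have hq := q.lt
    have hp' := p.pos
    -- The order compares `k` and the branch length `n - k` separately, so the maximum of each is
    -- taken.
    refine ⟨⟨max p.k q.k + max (p.n - p.k) (q.n - q.k), max p.k q.k, by omega, by omega⟩,
      ⟨?_, ?_, ?_⟩, ⟨?_, ?_, ?_⟩⟩ <;> simp only <;> omega

instance (k : ℕ) : IsDirectedOrder {p : RIndex | p.k = k} where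
  directed := by
    rintro ⟨p, hp⟩ ⟨q, hq⟩
    have hp' : p.k = k := hp
    have hq' : q.k = k := hq
    rcases le_total p.n q.n with h | h
    · have hle : p ≤ q := ⟨h, by omega, by omega⟩
      exact ⟨⟨q, hq⟩, hle, le_rfl⟩
    · have hle : q ≤ p := ⟨h, by omega, by omega⟩
      exact ⟨⟨p, hp⟩, le_rfl, hle⟩

theorem nonempty_setOf_k_eq {k : ℕ} (hk : 1 ≤ k) : Nonempty {p : RIndex | p.k = k} :=
  ⟨⟨⟨k + 1, k, hk, by omega⟩, rfl⟩⟩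

open BondedFamily

/-! ### Arcs in the limit for fixed `k` -/

namespace BroomCoords

variable {F : BondedFamily RIndex} {l : ℕ} (B : BroomCoords F l)
include B

theorem bond_of_k_eq {p q : RIndex} (h : q ≤ p) (hk : p.k = q.k) (u : F.V p) :
    B.lab (F.bond h u) = B.lab u ∧
      (B.len u ≤ p.n ∧ B.len (F.bond h u) = min (B.len u) q.n ∨
        p.n < B.len u ∧ B.len (F.bond h u) = q.n + 1) := by
  have h1 := h.1
  have hq := q.lt
  have hu := B.bounds u
  have hc := B.bond_cases h u
  have hsub : p.k - q.k = 0 := by omega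
  rw [hsub, Nat.sub_zero] at hc
  omega

variable {k : ℕ}

/-- The depth of a coordinate of a thread. -/
def tlen (i : {p : RIndex | p.k = k}) (u : (F.restrict {p | p.k = k}).V i) : ℕ :=
  B.len (p := (i : RIndex)) u

/-- The label of a coordinate of a thread. -/
def tlab (i : {p : RIndex | p.k = k}) (u : (F.restrict {p | p.k = k}).V i) : ℕ :=
  B.lab (p := (i : RIndex)) u

/-- This and the following versions replace the `k` of each index by the fixed one, so that `omega`
sees a single number. -/
theorem tbounds (i : {p : RIndex | p.k = k}) (u : (F.restrict {p | p.k = k}).V i) :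
    B.tlen i u ≤ (i : RIndex).n + l ∧ l ≤ 1 ∧ 1 ≤ B.tlab i u ∧ B.tlab i u ≤ k ∧ 1 ≤ k ∧
      k < (i : RIndex).n ∧ (B.tlen i u ≤ k ∨ (i : RIndex).n < B.tlen i u → B.tlab i u = 1) := by
  have h := B.bounds (p := (i : RIndex)) u
  rwa [show (i : RIndex).k = k from i.2] at h

theorem tbond {i j : {p : RIndex | p.k = k}} (h : j ≤ i) (u : (F.restrict {p | p.k = k}).V i) :
    B.tlab j ((F.restrict {p | p.k = k}).bond h u) = B.tlab i u ∧
      (B.tlen i u ≤ (i : RIndex).n ∧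
        B.tlen j ((F.restrict {p | p.k = k}).bond h u) = min (B.tlen i u) (j : RIndex).n ∨
      (i : RIndex).n < B.tlen i u ∧
        B.tlen j ((F.restrict {p | p.k = k}).bond h u) = (j : RIndex).n + 1) :=
  B.bond_of_k_eq (p := (i : RIndex)) (q := (j : RIndex)) h
    ((show (i : RIndex).k = k from i.2).trans (show (j : RIndex).k = k from j.2).symm) u

theorem text {i : {p : RIndex | p.k = k}} {u v : (F.restrict {p | p.k = k}).V i}
    (h : B.tlen i u = B.tlen i v ∧ B.tlab i u = B.tlab i v) : u = v :=
  B.ext (p := (i : RIndex)) u v h.1 h.2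

theorem texists (i : {p : RIndex | p.k = k}) (s b : ℕ) (hs : s ≤ (i : RIndex).n + l)
    (hb : 1 ≤ b) (hbk : b ≤ k) : ∃ u : (F.restrict {p | p.k = k}).V i,
      B.tlen i u = s ∧ (k < s → s ≤ (i : RIndex).n → B.tlab i u = b) := by
  have hi : (i : RIndex).k = k := i.2
  have h := B.exists_eq (i : RIndex) s b hs hb (hi.symm ▸ hbk)
  rwa [hi] at h

theorem tadj {i : {p : RIndex | p.k = k}} {u v : (F.restrict {p | p.k = k}).V i}
    (h : ((F.restrict {p | p.k = k}).graph i).Adj u v) :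
    B.tlen i u ≤ B.tlen i v + 1 ∧ B.tlen i v ≤ B.tlen i u + 1 ∧
    (B.tlab i u = B.tlab i v ∨ B.tlen i u ≤ k ∨ B.tlen i v ≤ k ∨
      (i : RIndex).n < B.tlen i u ∨ (i : RIndex).n < B.tlen i v) := by
  have h' := (B.adj_iff (p := (i : RIndex)) u v).1 h
  rwa [show (i : RIndex).k = k from i.2] at h'

theorem treach (i : {p : RIndex | p.k = k}) {β : ℕ} (hβ : 1 ≤ β) (hβk : β ≤ k)
    {S : Set ((F.restrict {p | p.k = k}).V i)} {u v : (F.restrict {p | p.k = k}).V i}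
    (hu : B.tlen i u ≤ k ∨ (i : RIndex).n < B.tlen i u ∨ B.tlab i u = β)
    (hv : B.tlen i v ≤ k ∨ (i : RIndex).n < B.tlen i v ∨ B.tlab i v = β)
    (huv : B.tlen i u ≤ B.tlen i v)
    (hS : ∀ w, (B.tlen i w ≤ k ∨ (i : RIndex).n < B.tlen i w ∨ B.tlab i w = β) →
      B.tlen i u ≤ B.tlen i w → B.tlen i w ≤ B.tlen i v → w ∈ S) :
    ((F.restrict {p | p.k = k}).graph i).Reach S u v := by
  have hi : (i : RIndex).k = k := i.2
  refine B.reach_of_onChain (p := (i : RIndex)) hβ (hi.symm ▸ hβk) ?_ u ?_ huv fun w hw => hS w ?_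
  · change B.tlen i v ≤ (i : RIndex).k ∨ _
    rwa [hi]
  · change B.tlen i u ≤ (i : RIndex).k ∨ _
    rwa [hi]
  · rwa [OnChain, hi] at hw

/-- Two threads on a common chain, the first above the second, are joined by an arc. -/
theorem exists_arc_chain {a b : (F.restrict {p | p.k = k}).Limit} (hab : a ≠ b) {β : ℕ}
    (hβ : 1 ≤ β) (hβk : β ≤ k)
    (ha : ∀ i, B.tlen i (proj _ i a) ≤ k ∨ (i : RIndex).n < B.tlen i (proj _ i a) ∨
      B.tlab i (proj _ i a) = β)
    (hb : ∀ i, B.tlen i (proj _ i b) ≤ k ∨ (i : RIndex).n < B.tlen i (proj _ i b) ∨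
      B.tlab i (proj _ i b) = β)
    (hle : ∀ i, B.tlen i (proj _ i a) ≤ B.tlen i (proj _ i b)) :
    ∃ S, (F.restrict {p | p.k = k}).limitGraph.IsArc a b S := by
  have hR := B.isRegular.restrict {p : RIndex | p.k = k}
  refine ⟨_, hR.isArc (i₀ := ⟨⟨k + 1, k, hβ.trans hβk, by omega⟩, rfl⟩)
    (C := fun i => {u | (B.tlen i u ≤ k ∨ (i : RIndex).n < B.tlen i u ∨ B.tlab i u = β) ∧
      B.tlen i (proj _ i a) ≤ B.tlen i u ∧ B.tlen i u ≤ B.tlen i (proj _ i b)})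
    (τ := fun i u => (B.tlen i u : ℤ)) (fun i => ⟨?_, ?_⟩) (fun i => ?_) (fun i => ?_)
    (fun i => ?_) (fun i j h => ?_) hab (fun i => ⟨ha i, le_rfl, hle i⟩)
    (fun i => ⟨hb i, hle i, le_rfl⟩) (fun i => ?_)⟩
  · rintro j m h - u ⟨hu1, hu2, hu3⟩
    have h1 : (j : RIndex).n ≤ (m : RIndex).n := h.1
    rw [Set.mem_ofPred_eq, ← bond_proj h a, ← bond_proj h b]
    have hu := B.tbounds m u
    have hbu := B.tbond h u
    have hba := B.tbond h (proj _ m a)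
    have hbb := B.tbond h (proj _ m b)
    omega
  · rintro j m h - c ⟨hc1, hc2, hc3⟩
    have h1 : (j : RIndex).n ≤ (m : RIndex).n := h.1
    rw [← bond_proj h a] at hc2
    rw [← bond_proj h b] at hc3
    have hm := hle m
    have hc := B.tbounds j c
    have ha' := B.tbounds m (proj _ m a)
    have hb' := B.tbounds m (proj _ m b)
    have hba := B.tbond h (proj _ m a)
    have hbb := B.tbond h (proj _ m b)
    -- The depth of `c` itself lifts it, unless `c` is a branch end at level `j` and `a` lies deeper
    -- at level `m`; hence the maximum. The bottom lifts to the bottom.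
    obtain ⟨s, hs⟩ : ∃ s, B.tlen j c ≤ (j : RIndex).n ∧
        s = max (B.tlen j c) (B.tlen m (proj _ m a)) ∨
        (j : RIndex).n < B.tlen j c ∧ s = (m : RIndex).n + 1 := by
      rcases le_or_gt (B.tlen j c) (j : RIndex).n with h2 | h2
      · exact ⟨_, Or.inl ⟨h2, rfl⟩⟩
      · exact ⟨_, Or.inr ⟨h2, rfl⟩⟩
    obtain ⟨d, hd, hdb⟩ := B.texists m s β (by omega) hβ hβk
    have hd' := B.tbounds m d
    have hbd := B.tbond h d
    refine ⟨d, ⟨by omega, by omega, by omega⟩, B.text ⟨by omega, by omega⟩⟩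
  · have key : ∀ u ∈ {u | (B.tlen i u ≤ k ∨ (i : RIndex).n < B.tlen i u ∨ B.tlab i u = β) ∧
        B.tlen i (proj _ i a) ≤ B.tlen i u ∧ B.tlen i u ≤ B.tlen i (proj _ i b)},
        ((F.restrict {p | p.k = k}).graph i).Reach {u | (B.tlen i u ≤ k ∨
          (i : RIndex).n < B.tlen i u ∨ B.tlab i u = β) ∧ B.tlen i (proj _ i a) ≤ B.tlen i u ∧
          B.tlen i u ≤ B.tlen i (proj _ i b)} (proj _ i a) u := by
      rintro u ⟨hu1, hu2, hu3⟩
      exact B.treach i hβ hβk (ha i) hu1 hu2 fun w hw h1 h2 => ⟨hw, h1, h2.trans hu3⟩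
    exact ReflGraph.isConnectedSet_of_reach fun u hu v hv => (key u hu).symm.trans (key v hv)
  · rintro u ⟨hu, -⟩ v ⟨hv, -⟩ huv
    have hu' := B.tbounds i u
    have hv' := B.tbounds i v
    have huv : B.tlen i u = B.tlen i v := by exact_mod_cast huv
    exact B.text ⟨huv, by omega⟩
  · rintro u - v - huv
    have := B.tadj huv
    omega
  · rintro u - v - huv
    have hbu := B.tbond h u
    have hbv := B.tbond h v
    omega
  · rintro u ⟨-, hu⟩
    omega

/-- Two threads on different branches are joined by an arc. -/
theorem exists_arc_branches {a b : (F.restrict {p | p.k = k}).Limit} (hab : a ≠ b) {β γ : ℕ}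
    (hβγ : β ≠ γ) (ha : ∀ i, k < B.tlen i (proj _ i a) ∧ B.tlen i (proj _ i a) ≤ (i : RIndex).n ∧
      B.tlab i (proj _ i a) = β)
    (hb : ∀ i, k < B.tlen i (proj _ i b) ∧ B.tlen i (proj _ i b) ≤ (i : RIndex).n ∧
      B.tlab i (proj _ i b) = γ) (hk : 1 ≤ k) :
    ∃ S, (F.restrict {p | p.k = k}).limitGraph.IsArc a b S := by
  have hR := B.isRegular.restrict {p : RIndex | p.k = k}
  -- The fork together with the pieces of both branches leading to `a` and `b`. This route avoids ε
  -- and so exists for the trees too.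
  let C : ∀ i, Set ((F.restrict {p | p.k = k}).V i) := fun i =>
    {u | B.tlen i u = k ∨ (k < B.tlen i u ∧ B.tlen i u ≤ (i : RIndex).n ∧
      (B.tlab i u = β ∧ B.tlen i u ≤ B.tlen i (proj _ i a) ∨
        B.tlab i u = γ ∧ B.tlen i u ≤ B.tlen i (proj _ i b)))}
  -- Signed distance from the fork, negative on the branch of `a`.
  let τ : ∀ i, (F.restrict {p | p.k = k}).V i → ℤ := fun i u =>
    if B.tlab i u = β ∧ k < B.tlen i u then k - B.tlen i u else B.tlen i u - k
  have hτ : ∀ i u, (B.tlab i u = β ∧ k < B.tlen i u ∧ τ i u = k - B.tlen i u) ∨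
      (¬ (B.tlab i u = β ∧ k < B.tlen i u) ∧ τ i u = B.tlen i u - k) := by
    intro i u
    simp only [τ]
    split_ifs with h
    · exact Or.inl ⟨h.1, h.2, rfl⟩
    · exact Or.inr ⟨h, rfl⟩
  have haC : ∀ i, proj _ i a ∈ C i := fun i =>
    Or.inr ⟨(ha i).1, (ha i).2.1, Or.inl ⟨(ha i).2.2, le_rfl⟩⟩
  have hbC : ∀ i, proj _ i b ∈ C i := fun i =>
    Or.inr ⟨(hb i).1, (hb i).2.1, Or.inr ⟨(hb i).2.2, le_rfl⟩⟩
  refine ⟨_, hR.isArc (i₀ := ⟨⟨k + 1, k, hk, by omega⟩, rfl⟩) (C := C)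
    (τ := τ) (fun i => ⟨?_, ?_⟩) (fun i => ?_) (fun i => ?_)
    (fun i => ?_) (fun i j h => ?_) hab haC hbC (fun i => ?_)⟩
  · intro j m h _ u hu
    have h1 : (j : RIndex).n ≤ (m : RIndex).n := h.1
    simp only [C, Set.mem_ofPred_eq] at hu ⊢
    rw [← bond_proj h a, ← bond_proj h b]
    have hu' := B.tbounds j ((F.restrict {p | p.k = k}).bond h u)
    have hbu := B.tbond h u
    have hba := B.tbond h (proj _ m a)
    have hbb := B.tbond h (proj _ m b)
    have ha' := ha m
    have hb' := hb m
    omega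
  · intro j m h _ c hc
    have h1 : (j : RIndex).n ≤ (m : RIndex).n := h.1
    simp only [C, Set.mem_ofPred_eq] at hc ⊢
    rw [← bond_proj h a, ← bond_proj h b] at hc
    have hc' := B.tbounds j c
    have ha' := ha m
    have hb' := hb m
    have hba := B.tbond h (proj _ m a)
    have hbb := B.tbond h (proj _ m b)
    obtain ⟨d, hd, hdb⟩ := B.texists m (B.tlen j c) (B.tlab j c) (by omega) (by omega) (by omega)
    have hd' := B.tbounds m d
    have hbd := B.tbond h d
    refine ⟨d, by omega, B.text ⟨by omega, by omega⟩⟩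
  · obtain ⟨o, ho, -⟩ := B.texists i k 1 ((B.tbounds i (proj _ i a)).2.2.2.2.2.1.le.trans
      (Nat.le_add_right _ _)) le_rfl hk
    have key : ∀ u ∈ C i, ((F.restrict {p | p.k = k}).graph i).Reach (C i) o u := by
      intro u hu
      have hu' := B.tbounds i u
      refine B.treach i hu'.2.2.1 hu'.2.2.2.1 (Or.inl ho.le) (Or.inr (Or.inr rfl)) ?_
        fun w hw h1 h2 => ?_
      · simp only [C, Set.mem_ofPred_eq] at hu
        omega
      · simp only [C, Set.mem_ofPred_eq] at hu ⊢
        omega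
    exact ReflGraph.isConnectedSet_of_reach fun u hu v hv => (key u hu).symm.trans (key v hv)
  · intro u hu v hv huv
    simp only [C, Set.mem_ofPred_eq] at hu hv
    have hu' := B.tbounds i u
    have hv' := B.tbounds i v
    have h1 := hτ i u
    have h2 := hτ i v
    exact B.text ⟨by omega, by omega⟩
  · intro u hu v hv huv
    simp only [C, Set.mem_ofPred_eq] at hu hv
    have := B.tadj huv
    have h1 := hτ i u
    have h2 := hτ i v
    omega
  · intro u hu v hv huv
    simp only [C, Set.mem_ofPred_eq] at hu hv
    have hbu := B.tbond h u
    have hbv := B.tbond h v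
    have hu' := B.tbounds j ((F.restrict {p | p.k = k}).bond h u)
    have h1 := hτ i u
    have h2 := hτ i v
    have hu'' := B.tbounds i u
    have h3 := hτ j ((F.restrict {p | p.k = k}).bond h u)
    have h4 := hτ j ((F.restrict {p | p.k = k}).bond h v)
    omega
  · intro u hu
    simp only [C, Set.mem_ofPred_eq] at hu
    have h1 := hτ i u
    have h2 := hτ i (proj _ i a)
    have h3 := hτ i (proj _ i b)
    have ha' := ha i
    have hb' := hb i
    omega

/-- The least index `(k + 1, k)` already tells whether a thread is on the path, on a branch and
which one, or at the bottom. Only threads on two different branches fail to share a chain. -/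
theorem isArcwiseConnected (hk : 1 ≤ k) :
    (F.restrict {p | p.k = k}).limitGraph.IsArcwiseConnected := by
  intro a b hab
  let i₀ : {p : RIndex | p.k = k} := ⟨⟨k + 1, k, hk, by omega⟩, rfl⟩
  have hi₀ : (i₀ : RIndex).n = k + 1 := rfl
  have hle : ∀ i : {p : RIndex | p.k = k}, i₀ ≤ i := fun i => by
    have hi : (i : RIndex).k = k := i.2
    have hlt := (i : RIndex).lt
    refine ⟨?_, hi.ge, ?_⟩ <;> simp only [i₀] <;> omega
  have hcoord : ∀ (x : (F.restrict {p | p.k = k}).Limit) i,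
      B.tlab i₀ (proj _ i₀ x) = B.tlab i (proj _ i x) ∧
      (B.tlen i (proj _ i x) ≤ (i : RIndex).n ∧
        B.tlen i₀ (proj _ i₀ x) = min (B.tlen i (proj _ i x)) (k + 1) ∨
      (i : RIndex).n < B.tlen i (proj _ i x) ∧ B.tlen i₀ (proj _ i₀ x) = k + 1 + 1) := by
    intro x i
    have := B.tbond (hle i) (proj _ i x)
    rwa [bond_proj] at this
  have hba := B.tbounds i₀ (proj _ i₀ a)
  have hbb := B.tbounds i₀ (proj _ i₀ b)
  by_cases hcase : (k < B.tlen i₀ (proj _ i₀ a) ∧ B.tlen i₀ (proj _ i₀ a) ≤ k + 1) ∧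
      (k < B.tlen i₀ (proj _ i₀ b) ∧ B.tlen i₀ (proj _ i₀ b) ≤ k + 1) ∧
      B.tlab i₀ (proj _ i₀ a) ≠ B.tlab i₀ (proj _ i₀ b)
  · refine B.exists_arc_branches hab hcase.2.2 (fun i => ?_) (fun i => ?_) hk
    · have := hcoord a i
      omega
    · have := hcoord b i
      omega
  · obtain ⟨β, hβ, hβk, hβa, hβb⟩ : ∃ β, 1 ≤ β ∧ β ≤ k ∧
        (B.tlen i₀ (proj _ i₀ a) ≤ k ∨ k + 1 < B.tlen i₀ (proj _ i₀ a) ∨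
          B.tlab i₀ (proj _ i₀ a) = β) ∧
        (B.tlen i₀ (proj _ i₀ b) ≤ k ∨ k + 1 < B.tlen i₀ (proj _ i₀ b) ∨
          B.tlab i₀ (proj _ i₀ b) = β) := by
      by_cases h : k < B.tlen i₀ (proj _ i₀ a) ∧ B.tlen i₀ (proj _ i₀ a) ≤ k + 1
      · exact ⟨_, hba.2.2.1, hba.2.2.2.1, Or.inr (Or.inr rfl), by omega⟩
      · exact ⟨_, hbb.2.2.1, hbb.2.2.2.1, by omega, Or.inr (Or.inr rfl)⟩
    have ha : ∀ i, B.tlen i (proj _ i a) ≤ k ∨ (i : RIndex).n < B.tlen i (proj _ i a) ∨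
        B.tlab i (proj _ i a) = β := fun i => by
      have := hcoord a i
      omega
    have hb : ∀ i, B.tlen i (proj _ i b) ≤ k ∨ (i : RIndex).n < B.tlen i (proj _ i b) ∨
        B.tlab i (proj _ i b) = β := fun i => by
      have := hcoord b i
      omega
    by_cases hall : ∀ i, B.tlen i (proj _ i a) ≤ B.tlen i (proj _ i b)
    · exact B.exists_arc_chain hab hβ hβk ha hb hall
    · push Not at hall
      obtain ⟨j, hj⟩ := hall
      -- If `b` is strictly above `a` at level `j`, this persists at a common upper level `m` and
      -- descends weakly to every `i`.
      obtain ⟨S, hS⟩ := B.exists_arc_chain hab.symm hβ hβk hb ha fun i => by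
        obtain ⟨m, hm, hm'⟩ := exists_ge_ge i j
        have h1 := B.tbond hm (proj _ m a)
        have h2 := B.tbond hm (proj _ m b)
        have h3 := B.tbond hm' (proj _ m a)
        have h4 := B.tbond hm' (proj _ m b)
        rw [bond_proj] at h1 h2 h3 h4
        omega
      exact ⟨S, hS.symm⟩

end BroomCoords

/-! ### The words avoiding `12/3` -/

theorem containsPattern12_3_of_getElem {w : List ℕ} {i j m : ℕ} (hij : i < j) (hjm : j < m)
    (hm : m < w.length) (h1 : w[i] = w[j]) (h2 : w[j] ≠ w[m]) :
    ContainsPattern (wordPartition w) pattern12_3 := by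
  refine ⟨OrderEmbedding.ofStrictMono
    ![⟨i, by omega⟩, ⟨j, by omega⟩, ⟨m, hm⟩] ?_, ?_⟩
  · rw [Fin.strictMono_iff_lt_succ]
    intro a
    fin_cases a
    · exact hij
    · exact hjm
  · ext a b
    have h3 : w[i] ≠ w[m] := h1 ▸ h2
    change w.get _ = w.get _ ↔ (![1, 1, 2] : Fin 3 → ℕ) a = ![1, 1, 2] b
    fin_cases a <;> fin_cases b <;> simp [h1, h2, h2.symm]

theorem le_maxLetter {w : List ℕ} {a : ℕ} (h : a ∈ w) : a ≤ maxLetter w := by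
  obtain ⟨s, t, rfl⟩ := List.append_of_mem h
  rw [maxLetter_append]
  exact le_max_of_le_right (by simp [maxLetter])

theorem maxLetter_le {w : List ℕ} {b : ℕ} (h : ∀ a ∈ w, a ≤ b) : maxLetter w ≤ b := by
  induction w with
  | nil => exact Nat.zero_le _
  | cons a w ih =>
    simp only [maxLetter, List.foldr_cons] at ih ⊢
    exact max_le (h a (by simp)) (ih fun c hc => h c (by simp [hc]))

theorem length_initialRun (s : ℕ) : (initialRun s).length = s := by simp [initialRun]

theorem initialRun_succ (s : ℕ) : initialRun (s + 1) = initialRun s ++ [s + 1] := by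
  rw [initialRun, List.range'_1_concat, add_comm 1 s]
  rfl

/-- The word `1 2 ⋯ k b b ⋯ b`, cut off or continued to length `s`. -/
def broomWord (k s b : ℕ) : List ℕ := initialRun (min s k) ++ List.replicate (s - k) b

theorem length_broomWord (k s b : ℕ) : (broomWord k s b).length = s := by
  simp only [broomWord, List.length_append, length_initialRun, List.length_replicate]
  omega

theorem broomWord_of_le {k s : ℕ} (h : s ≤ k) (b : ℕ) : broomWord k s b = initialRun s := by
  simp [broomWord, h]

theorem broomWord_succ (k s b : ℕ) :
    broomWord k (s + 1) b = broomWord k s b ++ [if s < k then s + 1 else b] := by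
  split_ifs with h
  · rw [broomWord_of_le h, broomWord_of_le h.le, initialRun_succ]
  · rw [broomWord, broomWord, min_eq_right (by omega), min_eq_right (by omega),
      show s + 1 - k = s - k + 1 by omega, List.replicate_succ', List.append_assoc]

theorem broomWord_prefix {k s t : ℕ} (h : s ≤ t) (b : ℕ) : broomWord k s b <+: broomWord k t b := by
  induction t, h using Nat.le_induction with
  | base => exact List.prefix_refl _
  | succ t _ ih =>
    rw [broomWord_succ k t]
    exact ih.trans (List.prefix_append _ _)

theorem getLastD_broomWord {k s : ℕ} (h : k < s) (b c : ℕ) : (broomWord k s b).getLastD c = b := by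
  obtain ⟨s, rfl⟩ : ∃ t, s = t + 1 := ⟨s - 1, by omega⟩
  rw [broomWord_succ, if_neg (by omega), List.getLastD_concat]

/-- As long as no letter repeats, restricted growth forces `1, 2, 3, …`. The first repetition
freezes the word, so it cannot occur before `k` has been reached; the next letter is at most `k` and
hence repeats. -/
theorem avoidingRGF_eq_broomWord {n k : ℕ} (hkn : k < n) {w : List ℕ}
    (hw : w ∈ avoidingRGF n k pattern12_3) :
    ∃ b, 1 ≤ b ∧ b ≤ k ∧ w = broomWord k n b := by
  obtain ⟨hrgf, hlen, hmax, hav⟩ := hw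
  have hle : ∀ (i : ℕ) (h : i < w.length), w[i] ≤ k := fun i h =>
    hmax ▸ le_maxLetter (List.getElem_mem h)
  have hpos : ∀ (i : ℕ) (h : i < w.length), 1 ≤ w[i] := fun i h =>
    hrgf.pos _ (List.getElem_mem h)
  have hrun : ∀ (s i : ℕ) (h : i < w.length), w.take s = initialRun s → i < s → w[i] = i + 1 := by
    intro s i h hs hi
    have h1 : (w.take s)[i]? = some (i + 1) := by
      rw [hs, initialRun, List.getElem?_range' hi]
      simp [add_comm]
    rw [List.getElem?_take_of_lt hi, List.getElem?_eq_getElem h] at h1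
    exact Option.some.inj h1
  have hrep : ∀ (s : ℕ) (h : s < w.length), w.take s = initialRun s → w[s] ≤ s →
      ∀ (j : ℕ) (hj : j < w.length), s ≤ j → w[j] = w[s] := by
    intro s h hs hws j hj hsj
    rcases hsj.eq_or_lt with rfl | hsj
    · rfl
    by_contra hne
    have hp := hpos s h
    -- The letter `w[s]` already occurs at position `w[s] - 1` of the initial run; together with a
    -- different letter at `j` this gives 12/3.
    refine hav (containsPattern12_3_of_getElem (i := w[s] - 1) (j := s) (m := j) (by omega) hsj hj
      ?_ (Ne.symm hne))
    rw [hrun s _ (by omega) hs (by omega)]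
    omega
  have htake : ∀ s ≤ k, w.take s = initialRun s := by
    intro s
    induction s with
    | zero => intro _; simp [initialRun]
    | succ s ih =>
      intro hs
      have ih := ih (by omega)
      have hsl : s < w.length := by omega
      rw [List.take_succ_eq_append_getElem hsl, ih, initialRun_succ]
      congr 2
      have hgrow : w[s] ≤ s + 1 := by
        rcases Nat.eq_zero_or_pos s with rfl | h0
        · exact (hrgf.first hsl).le
        · have := hrgf.growth s hsl h0
          rw [ih, maxLetter_initialRun] at this
          omega
      refine le_antisymm hgrow (not_lt.1 fun hlt => ?_)
      -- A repetition at `s < k` bounds all letters by `s`, contradicting the maximal letter `k`.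
      have hcon := hrep s hsl ih (by omega)
      have : maxLetter w ≤ s := maxLetter_le fun a ha => by
        obtain ⟨i, hi, rfl⟩ := List.getElem_of_mem ha
        rcases lt_or_ge i s with h | h
        · rw [hrun s i hi ih h]
          omega
        · rw [hcon i hi h]
          omega
      omega
  have hk : k < w.length := by omega
  have htk := htake k le_rfl
  refine ⟨w[k], hpos k hk, hle k hk, ?_⟩
  rw [broomWord, min_eq_right hkn.le, ← htk]
  conv_lhs => rw [← List.take_append_drop k w]
  congr 1
  refine List.eq_replicate_iff.2 ⟨by simp [hlen], fun a ha => ?_⟩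
  obtain ⟨i, hi, rfl⟩ := List.getElem_of_mem ha
  rw [List.getElem_drop]
  exact hrep k hk htk (hle k hk) _ _ (Nat.le_add_right _ _)

/-! ### Coordinates on the trees and the lattices -/

namespace TreeVertex

variable {p : RIndex}

/-- The label of the branch of a vertex, `1` on the initial path. -/
def label (u : TreeVertex p) : ℕ := if p.k < u.word.length then u.word.getLastD 1 else 1

theorem exists_word_eq (u : TreeVertex p) :
    ∃ b, 1 ≤ b ∧ b ≤ p.k ∧ u.word = broomWord p.k u.word.length b := by
  obtain ⟨w, hw, huw⟩ := u.mem
  have hlen := hw.2.1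
  obtain ⟨b, hb, hbk, rfl⟩ := avoidingRGF_eq_broomWord p.lt hw
  refine ⟨b, hb, hbk, ?_⟩
  exact (List.prefix_of_prefix_length_le huw (broomWord_prefix u.length_le b)
    (length_broomWord _ _ _).ge).eq_of_length (length_broomWord _ _ _).symm

theorem word_eq (u : TreeVertex p) : u.word = broomWord p.k u.word.length u.label := by
  obtain ⟨b, -, -, h⟩ := u.exists_word_eq
  rw [label]
  split_ifs with h1
  · conv_rhs => rw [h, length_broomWord, getLastD_broomWord h1]
    exact h
  · rw [broomWord_of_le (by omega)] at h ⊢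
    exact h

theorem label_pos (u : TreeVertex p) : 1 ≤ u.label := by
  rw [label]
  split_ifs
  · exact u.one_le_getLastD
  · exact le_rfl

theorem label_le (u : TreeVertex p) : u.label ≤ p.k := by
  obtain ⟨b, hb, hbk, h⟩ := u.exists_word_eq
  rw [label]
  split_ifs with h1
  · rw [h, getLastD_broomWord h1]
    exact hbk
  · exact p.pos

theorem label_eq_one {u : TreeVertex p} (h : u.word.length ≤ p.k) : u.label = 1 :=
  if_neg (not_lt.2 h)

/-- The vertex at depth `s` on the initial path or on the branch with label `b`. -/
def node (p : RIndex) (s b : ℕ) (hs : s ≤ p.n) (hb : 1 ≤ b) (hbk : b ≤ p.k) : TreeVertex p :=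
  ⟨broomWord p.k s b, _, branchWord_mem p b hb hbk, by
    have h := broomWord_prefix (k := p.k) hs b
    rwa [broomWord.eq_1 p.k p.n, min_eq_right p.lt.le] at h⟩

/-- Up to depth `k` all words of equal length agree, so the length decides; beyond it the last
letter is the label. -/
theorem step_iff (u v : TreeVertex p) : (∃ a, v.word = u.word ++ [a]) ↔
    v.word.length = u.word.length + 1 ∧ (u.label = v.label ∨ u.word.length ≤ p.k) := by
  constructor
  · rintro ⟨a, ha⟩
    have hlen : v.word.length = u.word.length + 1 := by simp [ha]
    refine ⟨hlen, ?_⟩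
    by_contra! hne
    have hu := u.word_eq
    have hv := v.word_eq
    rw [hlen, broomWord_succ, ha] at hv
    have hv := (List.append_inj' hv rfl).1
    have h1 := congrArg (fun w => List.getLastD w 0) hv
    rw [getLastD_broomWord hne.2] at h1
    have h2 := congrArg (fun w => List.getLastD w 0) hu
    simp only [getLastD_broomWord hne.2] at h1 h2
    exact hne.1 (h2.symm.trans h1)
  · rintro ⟨hlen, h⟩
    refine ⟨if u.word.length < p.k then u.word.length + 1 else v.label, ?_⟩
    have hu := u.word_eq
    have hv := v.word_eq
    rw [hlen, broomWord_succ] at hv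
    rw [hv]
    congr 1
    rcases h with h | h
    · rw [← h, ← hu]
    · rw [broomWord_of_le h] at hu ⊢
      exact hu.symm

theorem ext_coords {u v : TreeVertex p} (h : u.word.length = v.word.length)
    (h' : u.label = v.label) : u = v :=
  TreeVertex.ext (by rw [u.word_eq, v.word_eq, h, h'])

theorem length_collapse_path {q : RIndex} (h : q ≤ p) {u : TreeVertex p}
    (hu : u.word.length ≤ p.k) : (collapse h u).word.length = u.word.length - (p.k - q.k) := by
  simp [collapse, collapseWord, hu, length_initialRun]

theorem word_collapse_branch {q : RIndex} (h : q ≤ p) {u : TreeVertex p}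
    (hu : p.k < u.word.length) : (collapse h u).word = broomWord q.k
      (q.k + min (u.word.length - p.k) (q.n - q.k)) (if u.label ≤ q.k then u.label else 1) := by
  simp only [collapse, collapseWord, if_neg (not_le.2 hu), broomWord, label, if_pos hu]
  rw [min_eq_right (Nat.le_add_right _ _), Nat.add_sub_cancel_left]

theorem length_collapse_branch {q : RIndex} (h : q ≤ p) {u : TreeVertex p}
    (hu : p.k < u.word.length) :
    (collapse h u).word.length = q.k + min (u.word.length - p.k) (q.n - q.k) := by
  rw [word_collapse_branch h hu, length_broomWord]

theorem label_collapse {q : RIndex} (h : q ≤ p) {u : TreeVertex p} (hu : p.k < u.word.length) :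
    (collapse h u).label = if u.label ≤ q.k then u.label else 1 := by
  have hq := q.lt
  have h1 : q.k < (collapse h u).word.length := by
    rw [length_collapse_branch h hu]
    omega
  rw [label, if_pos h1, word_collapse_branch h hu, getLastD_broomWord]
  omega

theorem adj_iff (u v : TreeVertex p) : (treeGraph p).Adj u v ↔
    u.word.length ≤ v.word.length + 1 ∧ v.word.length ≤ u.word.length + 1 ∧
      (u.label = v.label ∨ u.word.length ≤ p.k ∨ v.word.length ≤ p.k) := by
  change u = v ∨ (∃ a, v.word = u.word ++ [a]) ∨ (∃ a, u.word = v.word ++ [a]) ↔ _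
  rw [step_iff, step_iff]
  have hu := label_eq_one (u := u)
  have hv := label_eq_one (u := v)
  have huv : u = v ↔ u.word.length = v.word.length ∧ u.label = v.label :=
    ⟨fun h => h ▸ ⟨rfl, rfl⟩, fun h => ext_coords h.1 h.2⟩
  rw [huv]
  omega

end TreeVertex

/-- The coordinates of the trees. -/
def treeCoords : BroomCoords treeFamily 0 where
  len {p} u := TreeVertex.word (p := p) u |>.length
  lab {p} u := TreeVertex.label (p := p) u
  le_one := Nat.zero_le 1
  len_le u := TreeVertex.length_le u
  lab_pos u := TreeVertex.label_pos u
  lab_le u := TreeVertex.label_le u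
  lab_eq_one {p} u h := by
    have := TreeVertex.length_le (p := p) u
    exact TreeVertex.label_eq_one (p := p) (by omega)
  ext {p} u v h h' := TreeVertex.ext_coords (p := p) h h'
  exists_eq p s b hs hb hbk := by
    refine ⟨TreeVertex.node p s b hs hb hbk, length_broomWord _ _ _, fun h _ => ?_⟩
    rw [TreeVertex.label, if_pos (by rwa [TreeVertex.node, length_broomWord])]
    exact getLastD_broomWord h b 1
  adj_iff {p} u v := by
    have hu := TreeVertex.length_le (p := p) u
    have hv := TreeVertex.length_le (p := p) v
    refine (TreeVertex.adj_iff (p := p) u v).trans ?_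
    omega
  len_root p := rfl
  len_bond_path h u hu := TreeVertex.length_collapse_path h hu
  len_bond_branch h u hu _ := TreeVertex.length_collapse_branch h hu
  len_bond_bot {p q} h u hu := absurd (TreeVertex.length_le (p := p) u) (not_le.2 hu)
  lab_bond h u hu _ := TreeVertex.label_collapse h hu

namespace LatticeVertex

variable {p : RIndex}

/-- The depth of a vertex, `n + 1` for the bottom vertex. -/
def depth (x : LatticeVertex p) : ℕ := x.recBotCoe (p.n + 1) fun u => u.word.length

/-- The label of the branch of a vertex, `1` for the bottom vertex. -/
def label (x : LatticeVertex p) : ℕ := x.recBotCoe 1 fun u => u.label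

theorem adj_coe (u v : TreeVertex p) :
    (latticeGraph p).Adj u v ↔ (treeGraph p).Adj u v := by
  simp [latticeGraph, treeGraph, ReflGraph.ofStep]

theorem adj_bot_right (u : TreeVertex p) :
    (latticeGraph p).Adj u ⊥ ↔ u.word.length = p.n := by
  simp [latticeGraph, ReflGraph.ofStep]

end LatticeVertex

/-- The coordinates of the lattices. -/
def latticeCoords : BroomCoords latticeFamily 1 where
  len {p} x := LatticeVertex.depth (p := p) x
  lab {p} x := LatticeVertex.label (p := p) x
  le_one := le_rfl
  len_le {p} x := by
    induction x using WithBot.recBotCoe with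
    | bot => exact le_rfl
    | coe u => exact (TreeVertex.length_le u).trans (Nat.le_succ _)
  lab_pos {p} x := by
    induction x using WithBot.recBotCoe with
    | bot => exact le_rfl
    | coe u => exact TreeVertex.label_pos u
  lab_le {p} x := by
    induction x using WithBot.recBotCoe with
    | bot => exact p.pos
    | coe u => exact TreeVertex.label_le u
  lab_eq_one {p} x h := by
    induction x using WithBot.recBotCoe with
    | bot => rfl
    | coe u => exact treeCoords.lab_eq_one (p := p) u h
  ext {p} x y h h' := by
    induction x using WithBot.recBotCoe with
    | bot =>
      induction y using WithBot.recBotCoe with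
      | bot => rfl
      | coe v => exact absurd (h.le.trans v.length_le) (Nat.not_succ_le_self _)
    | coe u =>
      induction y using WithBot.recBotCoe with
      | bot => exact absurd (h.ge.trans u.length_le) (Nat.not_succ_le_self _)
      | coe v => exact congrArg _ (TreeVertex.ext_coords h h')
  exists_eq p s b hs hb hbk := by
    rcases hs.lt_or_eq with hs | rfl
    · obtain ⟨u, hu⟩ := treeCoords.exists_eq p s b (Nat.lt_succ_iff.1 hs) hb hbk
      exact ⟨WithBot.some u, hu⟩
    · exact ⟨(⊥ : LatticeVertex p), rfl, fun _ h => absurd h (Nat.not_succ_le_self _)⟩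
  adj_iff {p} x y := by
    have hp := p.lt
    induction x using WithBot.recBotCoe with
    | bot =>
      induction y using WithBot.recBotCoe with
      | bot => exact ⟨fun _ => ⟨Nat.le_succ _, Nat.le_succ _, Or.inl rfl⟩,
          fun _ => (latticeGraph p).refl _⟩
      | coe v =>
        have h : (latticeGraph p).Adj ⊥ v ↔ v.word.length = p.n :=
          ⟨fun h => (LatticeVertex.adj_bot_right v).1 ((latticeGraph p).symm _ _ h),
            fun h => (latticeGraph p).symm _ _ ((LatticeVertex.adj_bot_right v).2 h)⟩
        refine h.trans ?_
        have hv := v.length_le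
        simp only [LatticeVertex.depth, WithBot.recBotCoe_bot, WithBot.recBotCoe_coe]
        omega
    | coe u =>
      induction y using WithBot.recBotCoe with
      | bot =>
        refine (LatticeVertex.adj_bot_right u).trans ?_
        have hu := u.length_le
        simp only [LatticeVertex.depth, WithBot.recBotCoe_bot, WithBot.recBotCoe_coe]
        omega
      | coe v => exact (LatticeVertex.adj_coe u v).trans (treeCoords.adj_iff (p := p) u v)
  len_root p := rfl
  len_bond_path {p q} h x hx := by
    induction x using WithBot.recBotCoe with
    | bot => exact absurd (hx.trans_lt p.lt) (not_lt.2 (Nat.le_succ _))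
    | coe u => exact TreeVertex.length_collapse_path h hx
  len_bond_branch {p q} h x hx hx' := by
    induction x using WithBot.recBotCoe with
    | bot => exact absurd hx' (Nat.not_succ_le_self _)
    | coe u => exact TreeVertex.length_collapse_branch h hx
  len_bond_bot {p q} h x hx := by
    induction x using WithBot.recBotCoe with
    | bot => rfl
    | coe u => exact absurd u.length_le (not_le.2 hx)
  lab_bond {p q} h x hx hx' := by
    induction x using WithBot.recBotCoe with
    | bot => exact absurd hx' (Nat.not_succ_le_self _)
    | coe u => exact TreeVertex.label_collapse h hx

/-! ### The trees are brooms -/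

theorem ReflGraph.Reach.reachable {V : Type} {G : ReflGraph V} {S : Set V} {a b : V}
    (h : G.Reach S a b) : G.toSimpleGraph.Reachable a b := by
  induction h with
  | refl => exact .refl _
  | @tail b c _ h ih =>
    by_cases hbc : b = c
    · exact hbc ▸ ih
    · exact ih.trans (SimpleGraph.Adj.reachable ⟨hbc, Or.inl h.1⟩)

/-- Every edge from `u` to its extension `v` is a bridge: the words extending `v` can be left only
by deleting the last letter of `v`, that is, along this edge. -/
theorem treeGraph_isTree (p : RIndex) : (treeGraph p).toSimpleGraph.IsTree := by
  have hne : Nonempty (TreeVertex p) := ⟨treeRoot p⟩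
  refine ⟨⟨fun u v => (treeCoords.reach_univ (p := p) u v).reachable⟩, ?_⟩
  rw [SimpleGraph.isAcyclic_iff_forall_isBridge]
  have key : ∀ u v : TreeVertex p, (∃ a, v.word = u.word ++ [a]) →
      (treeGraph p).toSimpleGraph.IsBridge s(u, v) := by
    rintro u v ⟨a, ha⟩
    rw [SimpleGraph.isBridge_iff]
    rintro hreach
    have hstep : ∀ w w' : TreeVertex p,
        ((treeGraph p).toSimpleGraph.deleteEdges {s(u, v)}).Adj w w' →
        v.word <+: w.word → v.word <+: w'.word := by
      intro w w' hadj hw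
      rw [SimpleGraph.deleteEdges_adj] at hadj
      obtain ⟨⟨hne, hadj⟩, hdel⟩ := hadj
      have hww : (∃ a, w'.word = w.word ++ [a]) ∨ ∃ a, w.word = w'.word ++ [a] := by
        rcases hadj with (h | h) | (h | h)
        · exact absurd h hne
        · exact h
        · exact absurd h.symm hne
        · exact h.symm
      rcases hww with ⟨b, hb⟩ | ⟨b, hb⟩
      · rw [hb]
        exact hw.trans (List.prefix_append _ _)
      · rw [hb, List.prefix_concat_iff] at hw
        refine hw.resolve_left fun h => hdel ?_
        have hwv : w = v := TreeVertex.ext (hb.trans h.symm)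
        have hwu : w' = u := TreeVertex.ext (List.append_inj' (h.symm.trans ha) rfl).1
        rw [hwv, hwu, Set.mem_singleton_iff]
        exact Sym2.eq_swap
    have hall : ∀ w, ((treeGraph p).toSimpleGraph.deleteEdges {s(u, v)}).Reachable v w →
        v.word <+: w.word := by
      intro w hw
      rw [SimpleGraph.reachable_iff_reflTransGen] at hw
      induction hw with
      | refl => exact List.prefix_refl _
      | tail _ h ih => exact hstep _ _ h ih
    have := (hall u hreach.symm).length_le
    rw [ha, List.length_append, List.length_singleton] at this
    omega
  intro e he
  induction e with | h u v => ?_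
  obtain ⟨hne, hadj⟩ := he
  have huv : (∃ a, v.word = u.word ++ [a]) ∨ ∃ a, u.word = v.word ++ [a] := by
    rcases hadj with (h | h) | (h | h)
    · exact absurd h hne
    · exact h
    · exact absurd h.symm hne
    · exact h.symm
  rcases huv with h | h
  · exact key u v h
  · rw [Sym2.eq_swap]
    exact key v u h

namespace BroomVertex

variable {k l : ℕ}

/-- The distance from the root. -/
def depth : BroomVertex k l → ℕ
  | .inl i => i
  | .inr (_, d) => k + 1 + d

/-- The label of the branch, `1` on the initial path. -/
def label : BroomVertex k l → ℕ
  | .inl _ => 1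
  | .inr (b, _) => b + 1

theorem step_iff (x y : BroomVertex k l) :
    BroomStep k l x y ↔ y.depth = x.depth + 1 ∧ (x.label = y.label ∨ x.depth ≤ k) := by
  constructor
  · rintro (⟨i, j, h⟩ | ⟨b, d, h⟩ | ⟨b, d, e, h⟩)
    · exact ⟨h, Or.inl rfl⟩
    · exact ⟨by simp [depth, h], Or.inr le_rfl⟩
    · exact ⟨by simp only [depth]; omega, Or.inl rfl⟩
  · rintro ⟨h1, h2⟩
    rcases x with i | ⟨b, d⟩ <;> rcases y with j | ⟨c, e⟩ <;> simp only [depth, label] at h1 h2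
    · exact .path i j h1
    · obtain rfl : i = Fin.last k := Fin.ext (by simp only [Fin.val_last]; omega)
      exact .fork c e (by simp only [Fin.val_last] at h1; omega)
    · omega
    · obtain rfl : b = c := Fin.ext (by omega)
      exact .branch b d e (by omega)

end BroomVertex

/-- The vertex of the model with the same coordinates. -/
def TreeVertex.toBroom {p : RIndex} (u : TreeVertex p) : BroomVertex p.k (p.n - p.k) :=
  if h : u.word.length ≤ p.k then .inl ⟨u.word.length, Nat.lt_succ_of_le h⟩
  -- Labels start at 1 and the model's branches at 0; the first vertex of a branch has depth `k +
  -- 1`.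
  else .inr (⟨u.label - 1, by have := u.label_pos; have := u.label_le; omega⟩,
    ⟨u.word.length - (p.k + 1), by have := u.length_le; omega⟩)

theorem TreeVertex.depth_toBroom {p : RIndex} (u : TreeVertex p) :
    u.toBroom.depth = u.word.length := by
  rw [toBroom]
  split_ifs with h
  · rfl
  · simp only [BroomVertex.depth]
    omega

theorem TreeVertex.label_toBroom {p : RIndex} (u : TreeVertex p) :
    u.toBroom.label = u.label := by
  rw [toBroom]
  split_ifs with h
  · exact (label_eq_one h).symm
  · have := u.label_pos
    simp only [BroomVertex.label]
    omega

theorem TreeVertex.adj_toBroom_iff {p : RIndex} (u v : TreeVertex p) :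
    (broomGraph p.k (p.n - p.k)).Adj u.toBroom v.toBroom ↔ (treeGraph p).Adj u v := by
  change _ = _ ∨ BroomStep _ _ _ _ ∨ BroomStep _ _ _ _ ↔
    u = v ∨ (∃ a, v.word = u.word ++ [a]) ∨ (∃ a, u.word = v.word ++ [a])
  rw [BroomVertex.step_iff, BroomVertex.step_iff, step_iff, step_iff]
  simp only [depth_toBroom, label_toBroom]
  refine or_congr_left ⟨fun h => ?_, fun h => h ▸ rfl⟩
  refine ext_coords ?_ ?_
  · rw [← depth_toBroom, h, depth_toBroom]
  · rw [← label_toBroom, h, label_toBroom]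

theorem TreeVertex.toBroom_surjective {p : RIndex} :
    Function.Surjective (toBroom : TreeVertex p → _) := by
  have hp := p.lt
  have hp' := p.pos
  rintro (i | ⟨b, d⟩)
  · refine ⟨node p i 1 (by omega) le_rfl p.pos, ?_⟩
    have h : (node p i 1 (by omega) le_rfl p.pos).word.length = i := length_broomWord _ _ _
    simp only [toBroom, h]
    rw [dif_pos (by omega)]
  · obtain ⟨u, hu, hub⟩ : ∃ u : TreeVertex p, u.word.length = p.k + 1 + d ∧
        (p.k < p.k + 1 + d → p.k + 1 + d ≤ p.n → u.label = b + 1) :=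
      treeCoords.exists_eq p _ _ (by omega) (by omega) (by omega)
    have hub := hub (by omega) (by omega)
    refine ⟨u, ?_⟩
    rw [toBroom, dif_neg (by omega)]
    refine congrArg Sum.inr (Prod.ext (Fin.ext ?_) (Fin.ext ?_)) <;> simp only <;> omega

theorem TreeVertex.isRootedIso_toBroom (p : RIndex) : (treeGraph p).IsRootedIso (treeRoot p)
    (broomGraph p.k (p.n - p.k)) (Sum.inl 0) TreeVertex.toBroom where
  inj u v h := by
    refine ext_coords ?_ ?_
    · rw [← depth_toBroom, h, depth_toBroom]
    · rw [← label_toBroom, h, label_toBroom]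
  epi :=
    { map_root := rfl
      epi :=
        { hom := fun u v h => (adj_toBroom_iff u v).2 h
          surj := toBroom_surjective
          edge_surj := fun x y hxy => by
            obtain ⟨u, rfl⟩ := toBroom_surjective x
            obtain ⟨v, rfl⟩ := toBroom_surjective y
            exact ⟨u, v, (adj_toBroom_iff u v).1 hxy, rfl, rfl⟩ } }

/-! ### The lattice order -/

namespace TreeVertex

variable {p : RIndex}

/-- The vertex spelled by a prefix. -/
def ofPrefix (u : TreeVertex p) {w : List ℕ} (h : w <+: u.word) : TreeVertex p :=
  ⟨w, u.mem.imp fun _ h' => ⟨h'.1, h.trans h'.2⟩⟩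

/-- The join is the longest common prefix. -/
theorem exists_isLUB (u v : TreeVertex p) : ∃ z : TreeVertex p, IsLUB {u, v} z := by
  classical
  let P : ℕ → Prop := fun m => u.word.take m <+: v.word
  have hP : P (Nat.findGreatest P u.word.length) :=
    Nat.findGreatest_spec (P := P) (Nat.zero_le _) (by simp [P])
  refine ⟨u.ofPrefix (List.take_prefix (Nat.findGreatest P u.word.length) u.word), ?_, ?_⟩
  · rintro x (rfl | rfl)
    · exact List.take_prefix _ _
    · exact hP
  · intro c hc
    have hcu : c.word <+: u.word := hc (Set.mem_insert _ _)
    have hcv : c.word <+: v.word := hc (Set.mem_insert_of_mem _ rfl)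
    have hlen : c.word.length ≤ Nat.findGreatest P u.word.length :=
      Nat.le_findGreatest hcu.length_le (by
        change _ <+: _
        rwa [← List.prefix_iff_eq_take.1 hcu])
    change c.word <+: u.word.take _
    rw [List.prefix_iff_eq_take.1 hcu]
    exact List.take_prefix_take_left hlen

theorem covBy_iff (u v : TreeVertex p) : v ⋖ u ↔ ∃ a, v.word = u.word ++ [a] := by
  constructor
  · intro h
    have huv : u.word <+: v.word := h.lt.le
    obtain ⟨t, ht⟩ := huv
    rcases t with _ | ⟨a, t⟩
    · rw [List.append_nil] at ht
      exact absurd (TreeVertex.ext ht) h.lt.ne'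
    · have hpre : u.word ++ [a] <+: v.word := ⟨t, by rw [← ht]; simp⟩
      let z := v.ofPrefix hpre
      have hvz : v ≤ z := hpre
      have hzu : z < u := lt_of_le_of_ne (List.prefix_append _ _) fun h => by
        have := congrArg (fun x : TreeVertex p => x.word.length) h
        simp [z, ofPrefix] at this
      refine ⟨a, ?_⟩
      by_contra hne
      exact h.2 (lt_of_le_of_ne hvz fun h => hne (congrArg TreeVertex.word h)) hzu
  · rintro ⟨a, ha⟩
    refine ⟨lt_of_le_of_ne ?_ fun h => ?_, fun z hvz hzu => ?_⟩
    · exact ⟨[a], ha.symm⟩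
    · have := congrArg (fun x : TreeVertex p => x.word.length) h
      simp [ha] at this
    · have h1 : z.word <+: v.word := hvz.le
      rw [ha, List.prefix_concat_iff] at h1
      rcases h1 with h1 | h1
      · exact hvz.ne' (TreeVertex.ext (h1.trans ha.symm))
      · have hle : u ≤ z := h1
        exact absurd hzu (not_lt_of_ge hle)

theorem isMin_iff (u : TreeVertex p) : IsMin u ↔ u.word.length = p.n := by
  constructor
  · intro h
    obtain ⟨w, hw, huw⟩ := u.mem
    let z : TreeVertex p := ⟨w, w, hw, List.prefix_refl w⟩
    have hzu : z ≤ u := huw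
    have huz : w <+: u.word := h hzu
    exact le_antisymm u.length_le (hw.2.1 ▸ huz.length_le)
  · intro h z hz
    have hz : u.word <+: z.word := hz
    have := hz.eq_of_length (le_antisymm hz.length_le (h ▸ z.length_le))
    exact le_of_eq (TreeVertex.ext this)

end TreeVertex

/-- Covers in the tree are one-letter extensions, and ε is covered by the minimal vertices, which
are the full words. Steps go downwards, hence the final swap. -/
theorem latticeGraph_adj_iff {p : RIndex} (x y : LatticeVertex p) :
    (latticeGraph p).Adj x y ↔ x = y ∨ x ⋖ y ∨ y ⋖ x := by
  have key : ∀ x y : LatticeVertex p,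
      ((∃ u v : TreeVertex p, x = u ∧ y = v ∧ ∃ a, v.word = u.word ++ [a]) ∨
        (∃ u : TreeVertex p, x = u ∧ u.word.length = p.n ∧ y = ⊥)) ↔ y ⋖ x := by
    intro x y
    induction x using WithBot.recBotCoe with
    | bot => simp
    | coe u =>
      induction y using WithBot.recBotCoe with
      | bot => rw [WithBot.bot_covBy_coe, TreeVertex.isMin_iff]; simp
      | coe v => simp [WithBot.coe_covBy_coe, TreeVertex.covBy_iff]
  refine or_congr_right ((or_congr (key x y) (key y x)).trans or_comm)

theorem LatticeVertex.exists_isLUB {p : RIndex} (x y : LatticeVertex p) :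
    ∃ z, IsLUB {x, y} z := by
  have hcomp : ∀ x y : LatticeVertex p, x ≤ y → IsLUB {x, y} y := fun x y hxy =>
    ⟨by rintro _ (rfl | rfl); exacts [hxy, le_rfl], fun c hc => hc (Set.mem_insert_of_mem _ rfl)⟩
  induction x using WithBot.recBotCoe with
  | bot => exact ⟨y, hcomp _ _ bot_le⟩
  | coe u =>
    induction y using WithBot.recBotCoe with
    | bot => exact ⟨u, Set.pair_comm _ _ ▸ hcomp _ _ bot_le⟩
    | coe v =>
      obtain ⟨z, hz, hz'⟩ := u.exists_isLUB v
      refine ⟨z, ?_, fun c hc => ?_⟩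
      · rintro _ (rfl | rfl)
        · exact WithBot.coe_le_coe.2 (hz (Set.mem_insert _ _))
        · exact WithBot.coe_le_coe.2 (hz (Set.mem_insert_of_mem _ rfl))
      · have hu := hc (Set.mem_insert _ _)
        have hv := hc (Set.mem_insert_of_mem _ rfl)
        induction c using WithBot.recBotCoe with
        | bot => exact absurd hu (WithBot.bot_lt_coe u).not_ge
        | coe c =>
          refine WithBot.coe_le_coe.2 (hz' ?_)
          rintro _ (rfl | rfl)
          · exact WithBot.coe_le_coe.1 hu
          · exact WithBot.coe_le_coe.1 hv

/-- Two prefixes of one word are comparable, so incomparable vertices have only ε below both. -/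
theorem LatticeVertex.exists_isGLB {p : RIndex} (x y : LatticeVertex p) :
    ∃ z, IsGLB {x, y} z := by
  have hcomp : ∀ x y : LatticeVertex p, x ≤ y → ∃ z, IsGLB {x, y} z := fun x y hxy =>
    ⟨x, by rintro _ (rfl | rfl); exacts [le_rfl, hxy], fun c hc => hc (Set.mem_insert _ _)⟩
  by_cases hxy : x ≤ y
  · exact hcomp x y hxy
  by_cases hyx : y ≤ x
  · rw [Set.pair_comm]
    exact hcomp y x hyx
  refine ⟨⊥, fun _ _ => bot_le, fun c hc => ?_⟩
  have hx := hc (Set.mem_insert _ _)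
  have hy := hc (Set.mem_insert_of_mem _ rfl)
  induction c using WithBot.recBotCoe with
  | bot => exact le_rfl
  | coe c =>
    induction x using WithBot.recBotCoe with
    | bot => exact absurd bot_le hxy
    | coe u =>
      induction y using WithBot.recBotCoe with
      | bot => exact absurd bot_le hyx
      | coe v =>
        have hu : u.word <+: c.word := WithBot.coe_le_coe.1 hx
        have hv : v.word <+: c.word := WithBot.coe_le_coe.1 hy
        rcases List.prefix_or_prefix_of_prefix hu hv with h | h
        · exact absurd (WithBot.coe_le_coe.2 (show v ≤ u from h)) hyx
        · exact absurd (WithBot.coe_le_coe.2 (show u ≤ v from h)) hxy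

theorem mainTheorem3 :
    -- each `R_{n,k}(12/3)` is a tree: a path of length `k` followed by `k` branches of length `n-k`
    (∀ p : RIndex, Finite (TreeVertex p) ∧ (treeGraph p).toSimpleGraph.IsTree ∧
      ∃ f : TreeVertex p → BroomVertex p.k (p.n - p.k),
        (treeGraph p).IsRootedIso (treeRoot p) (broomGraph p.k (p.n - p.k)) (Sum.inl 0) f) ∧
    -- adding a bottom element gives a lattice, of which `latticeGraph` is the Hasse diagram
    (∀ p : RIndex, ∀ x y : LatticeVertex p,
      (∃ z, IsLUB {x, y} z) ∧ (∃ z, IsGLB {x, y} z) ∧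
      ((latticeGraph p).Adj x y ↔ x = y ∨ x ⋖ y ∨ y ⋖ x)) ∧
    -- for the family of the trees, and for that of the lattices:
    (∀ F : BondedFamily RIndex, F = treeFamily ∨ F = latticeFamily →
      -- the collapsing maps are confluent epimorphisms of rooted graphs
      (∀ (p q : RIndex) (h : q ≤ p),
        (F.graph p).IsRootedEpi (F.root p) (F.graph q) (F.root q) (F.bond h) ∧
        (F.graph p).IsConfluent (F.graph q) (F.bond h)) ∧
      -- which are not always monotone
      (∃ (p q : RIndex) (h : q ≤ p), ¬ (F.graph p).IsMonotone (F.graph q) (F.bond h)) ∧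
      -- they form a projective Fraïssé family, and its limit is Kelley
      F.IsProjectiveFraisse ∧
      F.IsProjectiveFraisseLimit ∧
      F.limitGraph.IsKelley ∧
      -- for fixed `k` the same holds with monotone maps, and the limit is arcwise connected
      ∀ k : ℕ, 1 ≤ k →
        (∀ (p q : RIndex) (h : q ≤ p), p.k = k → q.k = k →
          (F.graph p).IsMonotone (F.graph q) (F.bond h)) ∧
        (F.restrict {p | p.k = k}).IsProjectiveFraisse ∧
        (F.restrict {p | p.k = k}).IsProjectiveFraisseLimit ∧
        (F.restrict {p | p.k = k}).limitGraph.IsArcwiseConnected) := by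
  refine ⟨fun p => ⟨treeCoords.finite p, treeGraph_isTree p, _, TreeVertex.isRootedIso_toBroom p⟩,
    fun p x y => ⟨LatticeVertex.exists_isLUB x y, LatticeVertex.exists_isGLB x y,
      latticeGraph_adj_iff x y⟩, fun F hF => ?_⟩
  -- Coordinates exist for both families, and the rest of the argument does not distinguish them.
  obtain ⟨l, ⟨B⟩⟩ : ∃ l, Nonempty (BroomCoords F l) := by
    rcases hF with rfl | rfl
    exacts [⟨0, ⟨treeCoords⟩⟩, ⟨1, ⟨latticeCoords⟩⟩]
  have hreg := B.isRegular
  refine ⟨fun p q h => ⟨hreg.isRootedEpi h, (hreg.liftsEdges h).isConfluent⟩,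
    B.exists_not_isMonotone, hreg.isProjectiveFraisse, hreg.isProjectiveFraisseLimit,
    hreg.isKelley fun p => ReflGraph.isConnectedSet_of_reach fun u _ v _ => B.reach_univ u v,
    fun k hk => ?_⟩
  have := nonempty_setOf_k_eq hk
  have hreg' := hreg.restrict {p | p.k = k}
  exact ⟨fun p q h hp hq => B.isMonotone h (hp.trans hq.symm), hreg'.isProjectiveFraisse,
    hreg'.isProjectiveFraisseLimit, B.isArcwiseConnected hk⟩
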